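/- Let $G$ and $H$ be second countable locally compact Hausdorff groupoids with open range and source maps and with (left) Haar systems $\{\lambda_G^u\}_{u\in G^{(0)}}$ and $\{\lambda_H^v\}_{v\in H^{(0)}}$. Let $G$ act (continuously, on the left) on $H$ by isomorphisms: the moment map $\rho:H\to G^{(0)}$ is a continuous open surjection, each $H_u=\rho^{-1}(u)$ is a subgroupoid of $H$, and for each $x\in G$ the map $h\mapsto x\cdot h$ is a groupoid isomorphism of $H_{s(x)}$ onto $H_{r(x)}$. Assume that the Haar system of $H$ is invariant: $\int f(x\cdot h)\,d\lambda_H^v(h)=\int f(h)\,d\lambda_H^{x\cdot v}(h)$ for all $f\in C_c(H)$ and all $x\in G$, $v\in H^{(0)}$ with $s(x)=\rho(v)$. Let $H\rtimes G=\{(h,x)\in H\times G:\rho(h)=r(x)\}$ be the semidirect product groupoid, with $(h,x)(k,y)=(h(x\cdot k),xy)$ when $s(h)=x\cdot r(k)$, and $(h,x)^{-1}=(x^{-1}\cdot h^{-1},x^{-1})$. Identify its unit space with $H^{(0)}$ through $v\mapsto(v,\rho(v))$, and give it the Haar system $\lambda_H^v\times\lambda_G^{\rho(v)}$, $v\in H^{(0)}$.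 Let $\mu$ be a finite quasi-invariant Borel measure on $H^{(0)}$ for $H\rtimes G$, with a modular function $\Delta:H\rtimes G\to(0,\infty)$ that is a Borel homomorphism, and put $\delta(v,x)=\Delta(v,x)$ for $v\in H^{(0)}$, $x\in G$, $\rho(v)=r(x)$. Let $\mu_G=\rho_*\mu$ be the push-forward of $\mu$ to $G^{(0)}$, let $\nu_G=\int\lambda_G^u\,d\mu_G(u)$, and let $\Delta_G:G\to(0,\infty)$ be a Borel homomorphism that is a modular function for $\mu_G$. (Here a modular function of a measure $m$ on the unit space of a groupoid $K$ with Haar system $\lambda$ is a function $D$ with $\int\!\int f(x^{-1})D(x^{-1})\,d\lambda^u(x)\,dm(u)=\int\!\int f(x)\,d\lambda^u(x)\,dm(u)$ for all Borel $f\ge0$ on $K$.) Let $\{\mu^u\}$ be a disintegration of $\mu$ with respect to $\rho$: the $\mu^u$ depend on $u$ in a Borel way, for $\mu_G$-almost every $u$ the measure $\mu^u$ is a probability measure on $H^{(0)}$ with support in $H^{(0)}\cap\rho^{-1}(u)$, and $\int f\,d\mu=\int_{G^{(0)}}\int_{H^{(0)}} f(v)\,d\mu^u(v)\,d\mu_G(u)$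 for all Borel $f\ge 0$ on $H^{(0)}$. Then there is a $\mu_G$-conull set $U\subset G^{(0)}$ such that the reduction $G|_U=\{x\in G: r(x)\in U,\ s(x)\in U\}$ is $\nu_G$-conull and such that for all $x\in G|_U$ $$\mu^{s(x)}=\delta(\cdot,x^{-1})\,\Delta_G(x)\,(x^{-1}\cdot\mu^{r(x)}),$$ where $x^{-1}\cdot\mu^{r(x)}$ is the image of $\mu^{r(x)}$ under $v\mapsto x^{-1}\cdot v$. That is, for all Borel functions $\phi:H^{(0)}\to[0,\infty]$ and all $x\in G|_U$, $$\int_{H^{(0)}}\phi(v)\,d\mu^{s(x)}(v)=\int_{H^{(0)}}\phi(x^{-1}\cdot v)\,\delta(x^{-1}\cdot v,x^{-1})\,\Delta_G(x)\,d\mu^{r(x)}(v).$$ -/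

import Mathlib

open MeasureTheory ProbabilityTheory Set
open scoped ENNReal

noncomputable section

/-- A groupoid, given as the set of its arrows. The product `mul x y` is meaningful only for
composable pairs, `src x = rng y`; its values on other pairs are never used. -/
class AlgGroupoid (G : Type*) where
  rng : G → G
  src : G → G
  mul : G → G → G
  inv : G → G
  rng_mul : ∀ x y, src x = rng y → rng (mul x y) = rng x
  src_mul : ∀ x y, src x = rng y → src (mul x y) = src y
  rng_inv : ∀ x, rng (inv x) = src x
  src_inv : ∀ x, src (inv x) = rng x
  mul_mul_eq : ∀ x y z, src x = rng y → src y = rng z → mul (mul x y) z = mul x (mul y z)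
  rng_mul_self : ∀ x, mul (rng x) x = x
  mul_src_self : ∀ x, mul x (src x) = x
  mul_inv_eq : ∀ x, mul x (inv x) = rng x
  inv_mul_eq : ∀ x, mul (inv x) x = src x

namespace AlgGroupoid

variable {G : Type*} [AlgGroupoid G]

theorem rng_rng (x : G) : rng (rng x) = rng x := by
  have h := rng_mul x (inv x) (rng_inv x).symm
  rwa [mul_inv_eq] at h

theorem src_rng (x : G) : src (rng x) = rng x := by
  have h := src_mul x (inv x) (rng_inv x).symm
  rwa [mul_inv_eq, src_inv] at h

theorem rng_src (x : G) : rng (src x) = src x := by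
  have h := rng_mul (inv x) x (src_inv x)
  rwa [inv_mul_eq, rng_inv] at h

theorem src_src (x : G) : src (src x) = src x := by
  have h := src_mul (inv x) x (src_inv x)
  rwa [inv_mul_eq] at h

theorem inv_mul_mul (x y : G) (h : src x = rng y) : mul (inv x) (mul x y) = y := by
  rw [← mul_mul_eq _ _ _ (src_inv x) h, inv_mul_eq, h, rng_mul_self]

theorem eq_inv_of_mul (x y : G) (h : src x = rng y) (hxy : mul x y = rng x) : y = inv x := by
  have := inv_mul_mul x y h
  rw [hxy, ← src_inv, mul_src_self] at this
  exact this.symm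

theorem inv_inv_eq (x : G) : inv (inv x) = x := by
  refine (eq_inv_of_mul (inv x) x (src_inv x) ?_).symm
  rw [inv_mul_eq, rng_inv]

theorem eq_src_of_mul_self (x : G) (h : src x = rng x) (hx : mul x x = x) : x = src x := by
  have := inv_mul_mul x x h
  rw [hx, inv_mul_eq] at this
  exact this.symm

end AlgGroupoid

open AlgGroupoid (rng src mul inv)

/-- The unit space, as a subset of the groupoid. -/
abbrev UnitSpace (G : Type*) [AlgGroupoid G] : Type _ := {u : G // rng u = u}

/-- The range map, as a map onto the unit space. -/
def rngU {G : Type*} [AlgGroupoid G] (x : G) : UnitSpace G := ⟨rng x, AlgGroupoid.rng_rng x⟩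

/-- The source map, as a map onto the unit space. -/
def srcU {G : Type*} [AlgGroupoid G] (x : G) : UnitSpace G := ⟨src x, AlgGroupoid.rng_src x⟩

/-- The reduction `G|_U`. -/
def reduction {G : Type*} [AlgGroupoid G] (U : Set (UnitSpace G)) : Set G :=
  {x | rngU x ∈ U ∧ srcU x ∈ U}

/-- A topological groupoid with open range and source maps. -/
class TopologicalGroupoid (G : Type*) [TopologicalSpace G] extends AlgGroupoid G where
  continuousOn_mul : ContinuousOn (fun p : G × G => mul p.1 p.2) {p | src p.1 = rng p.2}
  continuous_inv : Continuous (inv : G → G)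
  isOpenMap_rng : IsOpenMap (rngU : G → UnitSpace G)
  isOpenMap_src : IsOpenMap (srcU : G → UnitSpace G)

/-- A (left) Haar system. Radon measures on a second countable locally compact Hausdorff space
are the Borel measures that are finite on compact sets. -/
structure IsHaarSystem {G : Type*} [TopologicalSpace G] [MeasurableSpace G]
    [TopologicalGroupoid G] (lam : UnitSpace G → Measure G) : Prop where
  finite_compacts : ∀ u, IsFiniteMeasureOnCompacts (lam u)
  support_eq : ∀ u, (lam u).support = {x | rngU x = u}
  continuous_integral : ∀ f : G → ℝ, Continuous f → HasCompactSupport f →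
    Continuous fun u => ∫ x, f x ∂(lam u)
  left_invariant : ∀ f : G → ℝ, Continuous f → HasCompactSupport f → ∀ x : G,
    ∫ y, f (mul x y) ∂(lam (srcU x)) = ∫ y, f y ∂(lam (rngU x))

/-- A Borel homomorphism `Δ : G → (0, ∞)` that is a modular function for the measure `μ` on the
unit space: with `ν(f) = ∫ ∫ f dλᵘ dμ(u)` and `ν⁻¹` the image of `ν` under inversion,
`ν = Δ ν⁻¹`. In particular, `ν` and `ν⁻¹` are equivalent, so that `μ` is quasi-invariant. -/
structure IsModularFunction {G : Type*} [MeasurableSpace G] [AlgGroupoid G]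
    (lam : UnitSpace G → Measure G) (μ : Measure (UnitSpace G)) (Δ : G → ℝ) : Prop where
  measurable : Measurable Δ
  pos : ∀ x, 0 < Δ x
  map_mul : ∀ x y, src x = rng y → Δ (mul x y) = Δ x * Δ y
  lintegral_inv : ∀ f : G → ℝ≥0∞, Measurable f →
    ∫⁻ u, ∫⁻ x, f (inv x) * ENNReal.ofReal (Δ (inv x)) ∂(lam u) ∂μ
      = ∫⁻ u, ∫⁻ x, f x ∂(lam u) ∂μ

/-- A continuous left action of a groupoid `G` on a space `T`. The value `act x t` is meaningful
only if `src x = moment t`; its other values are never used. -/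
structure GroupoidAction (G T : Type*) [TopologicalSpace G] [TopologicalGroupoid G]
    [TopologicalSpace T] where
  moment : T → UnitSpace G
  act : G → T → T
  continuous_moment : Continuous moment
  continuousOn_act :
    ContinuousOn (fun p : G × T => act p.1 p.2) {p | src p.1 = (moment p.2 : G)}
  moment_act : ∀ x t, src x = (moment t : G) → (moment (act x t) : G) = rng x
  moment_smul_self : ∀ t, act (moment t : G) t = t
  act_act : ∀ x y t, src x = rng y → src y = (moment t : G) →
    act x (act y t) = act (mul x y) t

/-- An action of `G` on a groupoid `H` by isomorphisms: the moment map is a continuous open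
surjection whose fibres `H_u` are subgroupoids, and each `x` acts as a groupoid isomorphism
of `H_{s(x)}` onto `H_{r(x)}` (bijectivity is automatic, as `x⁻¹` acts as the inverse map). -/
structure IsoAction (G H : Type*) [TopologicalSpace G] [TopologicalGroupoid G]
    [TopologicalSpace H] [TopologicalGroupoid H] extends GroupoidAction G H where
  surjective_moment : Function.Surjective moment
  isOpenMap_moment : IsOpenMap moment
  moment_inv : ∀ h, moment (inv h) = moment h
  moment_mul : ∀ h k, src h = rng k → moment h = moment k → moment (mul h k) = moment h
  src_act_eq_rng_act : ∀ x h k, src h = rng k → src x = (moment h : G) → src x = (moment k : G) →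
    src (act x h) = rng (act x k)
  act_mul : ∀ x h k, src h = rng k → src x = (moment h : G) → src x = (moment k : G) →
    act x (mul h k) = mul (act x h) (act x k)

namespace IsoAction

open AlgGroupoid

variable {G H : Type*} [TopologicalSpace G] [TopologicalGroupoid G]
  [TopologicalSpace H] [TopologicalGroupoid H] (A : IsoAction G H)

theorem moment_rng (h : H) : A.moment (rng h) = A.moment h := by
  have := A.moment_mul h (inv h) (rng_inv h).symm (A.moment_inv h).symm
  rwa [mul_inv_eq] at this

theorem moment_src (h : H) : A.moment (src h) = A.moment h := by
  rw [← rng_inv, moment_rng, moment_inv]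

theorem moment_eq {h k : H} (hk : src h = rng k) : A.moment h = A.moment k := by
  rw [← A.moment_src h, hk, moment_rng]

theorem act_rng (x : G) (h : H) (hx : src x = (A.moment h : G)) :
    A.act x (rng h) = rng (A.act x h) := by
  have hr : src x = (A.moment (rng h) : G) := by rw [moment_rng, hx]
  have hc : src (rng h) = rng (rng h) := by rw [src_rng, rng_rng]
  have h1 := A.act_mul x (rng h) (rng h) hc hr hr
  have e : mul (rng h) (rng h) = rng h := by
    have := rng_mul_self (rng h)
    rwa [rng_rng] at this
  rw [e] at h1
  rw [eq_src_of_mul_self _ (A.src_act_eq_rng_act x _ _ hc hr hr) h1.symm]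
  exact A.src_act_eq_rng_act x (rng h) h (src_rng h) hr hx

theorem act_inv (x : G) (h : H) (hx : src x = (A.moment h : G)) :
    A.act x (inv h) = inv (A.act x h) := by
  have hi : src x = (A.moment (inv h) : G) := by rw [moment_inv, hx]
  apply eq_inv_of_mul
  · exact A.src_act_eq_rng_act x h (inv h) (rng_inv h).symm hx hi
  · rw [← A.act_mul x h (inv h) (rng_inv h).symm hx hi, mul_inv_eq, A.act_rng x h hx]

theorem act_src (x : G) (h : H) (hx : src x = (A.moment h : G)) :
    A.act x (src h) = src (A.act x h) := by
  rw [← rng_inv, A.act_rng x (inv h) (by rw [moment_inv, hx]), A.act_inv x h hx, rng_inv]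

theorem act_inv_act (x : G) (h : H) (hx : src x = (A.moment h : G)) :
    A.act (inv x) (A.act x h) = h := by
  rw [A.act_act _ _ _ (src_inv x) hx, inv_mul_eq, hx, A.moment_smul_self]

theorem act_act_inv (x : G) (h : H) (hx : rng x = (A.moment h : G)) :
    A.act x (A.act (inv x) h) = h := by
  rw [A.act_act _ _ _ (rng_inv x).symm (by rw [src_inv, hx]), mul_inv_eq, hx, A.moment_smul_self]

/-- The moment map restricted to the unit space of `H`. -/
def momentU (v : UnitSpace H) : UnitSpace G := A.moment v.1

/-- The action on the unit space of `H`. If `src x = momentU v`, then `x · v` is a unit, so that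
it coincides with `r(x · v)`; the range only serves to have a total function. -/
def actU (x : G) (v : UnitSpace H) : UnitSpace H := rngU (A.act x v.1)

theorem coe_actU (x : G) (v : UnitSpace H) (hx : src x = (A.momentU v : G)) :
    (A.actU x v : H) = A.act x v.1 := by
  have := A.act_rng x v.1 hx
  rw [v.2] at this
  exact this.symm

/-- The Haar system of `H` is invariant under the action of `G`. -/
def IsInvariant [MeasurableSpace H] (lamH : UnitSpace H → Measure H) : Prop :=
  ∀ (f : H → ℝ), Continuous f → HasCompactSupport f →
    ∀ (x : G) (v : UnitSpace H), src x = (A.momentU v : G) →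
      ∫ h, f (A.act x h) ∂(lamH v) = ∫ h, f h ∂(lamH (A.actU x v))

/-- The set underlying the semidirect product groupoid of `H` by `G`. -/
def Semidirect : Type _ := {p : H × G // (A.moment p.1 : G) = rng p.2}

instance [MeasurableSpace G] [MeasurableSpace H] : MeasurableSpace A.Semidirect :=
  inferInstanceAs (MeasurableSpace {p : H × G // (A.moment p.1 : G) = rng p.2})

namespace Semidirect

variable {A}

theorem src_inv_snd (p : A.Semidirect) : src (inv p.1.2) = (A.moment p.1.1 : G) := by
  rw [src_inv]; exact p.2.symm

/-- `r(h, x) = (r(h), r(x))`. -/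
def rng' (p : A.Semidirect) : A.Semidirect :=
  ⟨(rng p.1.1, rng p.1.2), by
    show (A.moment (rng p.1.1) : G) = rng (rng p.1.2)
    rw [A.moment_rng, rng_rng]; exact p.2⟩

/-- `s(h, x) = (x⁻¹ · s(h), s(x))`. -/
def src' (p : A.Semidirect) : A.Semidirect :=
  ⟨(A.act (inv p.1.2) (src p.1.1), src p.1.2), by
    show (A.moment (A.act (inv p.1.2) (src p.1.1)) : G) = rng (src p.1.2)
    rw [A.moment_act _ _ (by rw [A.moment_src]; exact src_inv_snd p), rng_inv, rng_src]⟩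

/-- `(h, x)⁻¹ = (x⁻¹ · h⁻¹, x⁻¹)`. -/
def inv' (p : A.Semidirect) : A.Semidirect :=
  ⟨(A.act (inv p.1.2) (inv p.1.1), inv p.1.2), by
    show (A.moment (A.act (inv p.1.2) (inv p.1.1)) : G) = rng (inv p.1.2)
    rw [A.moment_act _ _ (by rw [A.moment_inv]; exact src_inv_snd p)]⟩

theorem comp_iff (p q : A.Semidirect) : src' p = rng' q ↔
    src p.1.2 = rng q.1.2 ∧ src p.1.1 = A.act p.1.2 (rng q.1.1) := by
  have key : src' p = rng' q ↔
      A.act (inv p.1.2) (src p.1.1) = rng q.1.1 ∧ src p.1.2 = rng q.1.2 := by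
    rw [← Prod.mk.injEq]
    exact Subtype.ext_iff
  rw [key]
  constructor
  · rintro ⟨h1, h2⟩
    refine ⟨h2, ?_⟩
    rw [← h1, A.act_act_inv _ _ (by rw [A.moment_src]; exact p.2.symm)]
  · rintro ⟨h1, h2⟩
    refine ⟨?_, h1⟩
    rw [h2, A.act_inv_act _ _ (by rw [A.moment_rng, h1]; exact q.2.symm)]

theorem comp_moment {p q : A.Semidirect} (h : src p.1.2 = rng q.1.2) :
    src p.1.2 = (A.moment q.1.1 : G) := by rw [h]; exact q.2.symm

theorem comp_src {p q : A.Semidirect} (h : src' p = rng' q) :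
    src p.1.1 = rng (A.act p.1.2 q.1.1) := by
  have := (comp_iff p q).1 h
  rw [this.2, A.act_rng _ _ (comp_moment this.1)]

/-- `(h, x)(k, y) = (h (x · k), x y)` for composable pairs. -/
def mulOf (p q : A.Semidirect) (h : src' p = rng' q) : A.Semidirect :=
  ⟨(mul p.1.1 (A.act p.1.2 q.1.1), mul p.1.2 q.1.2), by
    have hc := (comp_iff p q).1 h
    show (A.moment (mul p.1.1 (A.act p.1.2 q.1.1)) : G) = rng (mul p.1.2 q.1.2)
    rw [A.moment_mul _ _ (comp_src h) (A.moment_eq (comp_src h)), rng_mul _ _ hc.1]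
    exact p.2⟩

open Classical in
/-- The product, with an arbitrary value on pairs that are not composable. -/
def mul' (p q : A.Semidirect) : A.Semidirect :=
  if h : src' p = rng' q then mulOf p q h else p

theorem mul'_eq {p q : A.Semidirect} (h : src' p = rng' q) : mul' p q = mulOf p q h := dif_pos h

theorem ext' {p q : A.Semidirect} (h1 : p.1.1 = q.1.1) (h2 : p.1.2 = q.1.2) : p = q :=
  Subtype.ext (Prod.ext h1 h2)

theorem rng'_mul (p q : A.Semidirect) (h : src' p = rng' q) : rng' (mul' p q) = rng' p := by
  rw [mul'_eq h]
  exact ext' (rng_mul _ _ (comp_src h)) (rng_mul _ _ ((comp_iff p q).1 h).1)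

theorem src'_mul (p q : A.Semidirect) (h : src' p = rng' q) : src' (mul' p q) = src' q := by
  rw [mul'_eq h]
  have hc := (comp_iff p q).1 h
  have hm := comp_moment hc.1
  refine ext' ?_ (src_mul _ _ hc.1)
  show A.act (inv (mul p.1.2 q.1.2)) (src (mul p.1.1 (A.act p.1.2 q.1.1)))
    = A.act (inv q.1.2) (src q.1.1)
  have hq : rng q.1.2 = (A.moment (src q.1.1) : G) := by rw [A.moment_src]; exact q.2.symm
  have hi : src (inv q.1.2) = (A.moment (src q.1.1) : G) := by rw [src_inv, hq]
  rw [src_mul _ _ (comp_src h), ← A.act_src _ _ hm]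
  conv_lhs => rw [← A.act_act_inv q.1.2 (src q.1.1) hq]
  have h3 : src q.1.2 = (A.moment (A.act (inv q.1.2) (src q.1.1)) : G) := by
    rw [A.moment_act _ _ hi, rng_inv]
  rw [A.act_act _ _ _ hc.1 h3]
  exact A.act_inv_act _ _ (by rw [src_mul _ _ hc.1, h3])

theorem rng'_inv (p : A.Semidirect) : rng' (inv' p) = src' p :=
  ext' (by
    show rng (A.act (inv p.1.2) (inv p.1.1)) = A.act (inv p.1.2) (src p.1.1)
    rw [← A.act_rng _ _ (by rw [A.moment_inv]; exact src_inv_snd p), rng_inv]) (rng_inv _)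

theorem inv'_inv (p : A.Semidirect) : inv' (inv' p) = p := by
  refine ext' ?_ (inv_inv_eq _)
  show A.act (inv (inv p.1.2)) (inv (A.act (inv p.1.2) (inv p.1.1))) = p.1.1
  have h := src_inv_snd p
  rw [← A.act_inv _ _ (by rw [A.moment_inv]; exact h), inv_inv_eq, inv_inv_eq,
    A.act_act_inv _ _ p.2.symm]

theorem src'_inv (p : A.Semidirect) : src' (inv' p) = rng' p := by
  rw [← rng'_inv, inv'_inv]

theorem mul'_assoc (p q t : A.Semidirect) (h1 : src' p = rng' q) (h2 : src' q = rng' t) :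
    mul' (mul' p q) t = mul' p (mul' q t) := by
  have e1 : src' (mul' p q) = rng' t := by rw [src'_mul p q h1, h2]
  have e2 : src' p = rng' (mul' q t) := by rw [rng'_mul q t h2, h1]
  have c1 := (comp_iff p q).1 h1
  have c2 := (comp_iff q t).1 h2
  have hm := comp_moment c2.1
  have hq : src p.1.2 = (A.moment q.1.1 : G) := comp_moment c1.1
  have hqt : src p.1.2 = (A.moment (A.act q.1.2 t.1.1) : G) := by
    rw [A.moment_act _ _ hm, c1.1]
  have hs : src (A.act p.1.2 q.1.1) = rng (A.act p.1.2 (A.act q.1.2 t.1.1)) :=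
    A.src_act_eq_rng_act _ _ _ (comp_src h2) hq hqt
  rw [mul'_eq e1, mul'_eq e2]
  refine ext' ?_ ?_
  · show mul (mul' p q).1.1 (A.act (mul' p q).1.2 t.1.1) = mul p.1.1 (A.act p.1.2 (mul' q t).1.1)
    rw [mul'_eq h1, mul'_eq h2]
    show mul (mul p.1.1 (A.act p.1.2 q.1.1)) (A.act (mul p.1.2 q.1.2) t.1.1)
      = mul p.1.1 (A.act p.1.2 (mul q.1.1 (A.act q.1.2 t.1.1)))
    rw [A.act_mul _ _ _ (comp_src h2) hq hqt, ← A.act_act _ _ _ c1.1 hm,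
      mul_mul_eq _ _ _ (comp_src h1) hs]
  · show mul (mul' p q).1.2 t.1.2 = mul p.1.2 (mul' q t).1.2
    rw [mul'_eq h1, mul'_eq h2]
    exact mul_mul_eq _ _ _ c1.1 c2.1

theorem src'_rng' (p : A.Semidirect) : src' (rng' p) = rng' p := by
  refine ext' ?_ (src_rng _)
  show A.act (inv (rng p.1.2)) (src (rng p.1.1)) = rng p.1.1
  have e : inv (rng p.1.2) = rng p.1.2 := by
    refine (eq_inv_of_mul _ _ (by rw [src_rng, rng_rng]) ?_).symm
    have := rng_mul_self (rng p.1.2)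
    rwa [rng_rng] at this ⊢
  rw [e, src_rng, ← p.2, ← A.moment_rng, A.moment_smul_self]

theorem rng'_mul_self (p : A.Semidirect) : mul' (rng' p) p = p := by
  have h := src'_rng' p
  rw [mul'_eq h]
  refine ext' ?_ (rng_mul_self _)
  show mul (rng p.1.1) (A.act (rng p.1.2) p.1.1) = p.1.1
  rw [← p.2, A.moment_smul_self, rng_mul_self]

theorem mul'_inv (p : A.Semidirect) : mul' p (inv' p) = rng' p := by
  rw [mul'_eq (rng'_inv p).symm]
  refine ext' ?_ (mul_inv_eq _)
  show mul p.1.1 (A.act p.1.2 (A.act (inv p.1.2) (inv p.1.1))) = rng p.1.1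
  rw [A.act_act_inv _ _ (by rw [A.moment_inv]; exact p.2.symm), mul_inv_eq]

theorem inv'_mul (p : A.Semidirect) : mul' (inv' p) p = src' p := by
  have := mul'_inv (inv' p)
  rwa [inv'_inv, rng'_inv] at this

theorem mul'_src_self (p : A.Semidirect) : mul' p (src' p) = p := by
  rw [← inv'_mul, ← mul'_assoc _ _ _ (rng'_inv p).symm (src'_inv p), mul'_inv, rng'_mul_self]

/-- The semidirect product groupoid. -/
instance : AlgGroupoid A.Semidirect where
  rng := rng'
  src := src'
  mul := mul'
  inv := inv'
  rng_mul := rng'_mul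
  src_mul := src'_mul
  rng_inv := rng'_inv
  src_inv := src'_inv
  mul_mul_eq := mul'_assoc
  rng_mul_self := rng'_mul_self
  mul_src_self := mul'_src_self
  mul_inv_eq := mul'_inv
  inv_mul_eq := inv'_mul

end Semidirect

/-- The inclusion `v ↦ (v, ρ(v))` identifying the unit space of `H` with the unit space of the
semidirect product. -/
def semidirectUnit (v : UnitSpace H) : UnitSpace A.Semidirect :=
  ⟨⟨(v.1, (A.momentU v).1), (A.momentU v).2.symm⟩,
    Semidirect.ext' v.2 (A.momentU v).2⟩

/-- The Haar system `dλ^{(v,w)}(h,x) = dλ_H^v(h) dλ_G^w(x)` of the semidirect product. -/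
def semidirectHaar [MeasurableSpace G] [MeasurableSpace H]
    (lamH : UnitSpace H → Measure H) (lamG : UnitSpace G → Measure G) :
    UnitSpace A.Semidirect → Measure A.Semidirect := fun p =>
  ((lamH (rngU p.1.1.1)).prod (lamG (rngU p.1.1.2))).comap Subtype.val

open Classical in
/-- The restriction `δ(v, x) = Δ(v, x)` of `Δ` to the closed subgroupoid of all `(v, x)` in the
semidirect product with `v` a unit, extended by `0` to the pairs with `ρ(v) ≠ r(x)`. -/
def unitRestriction (Δ : A.Semidirect → ℝ) (v : UnitSpace H) (x : G) : ℝ :=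
  if h : (A.momentU v : G) = rng x then Δ ⟨(v.1, x), h⟩ else 0

/-- The image `x · m` of a measure `m` on the unit space of `H` under `v ↦ x · v`, a map which is
defined where `ρ(v) = s(x)`. -/
def translate [MeasurableSpace H] (x : G) (m : Measure (UnitSpace H)) : Measure (UnitSpace H) :=
  (m.restrict {v | src x = (A.momentU v : G)}).map (A.actU x)

end IsoAction

/-- The family `κ` disintegrates the measure `μ` with respect to `ρ`: for almost all `u` with
respect to `ρ_* μ`, `κ u` is a probability measure supported in `ρ⁻¹(u)`, and `μ` is the integral
of the measures `κ u` with respect to `ρ_* μ`. -/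
structure IsDisintegration {X Y : Type*} [MeasurableSpace X] [MeasurableSpace Y]
    (μ : Measure X) (ρ : X → Y) (κ : Kernel Y X) : Prop where
  ae_isProbabilityMeasure : ∀ᵐ u ∂(μ.map ρ), IsProbabilityMeasure (κ u)
  ae_fibre : ∀ᵐ u ∂(μ.map ρ), κ u {v | ρ v ≠ u} = 0
  lintegral_eq : ∀ f : X → ℝ≥0∞, Measurable f →
    ∫⁻ v, f v ∂μ = ∫⁻ u, ∫⁻ v, f v ∂(κ u) ∂(μ.map ρ)

end

/-!
Write `ρ` for the moment map, and let `p` be a nonnegative Borel function on `H ⋊ G` of integral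
`1` over each range fibre. The first step is that `δ`, the restriction of `Δ` to the closed
subgroupoid `H⁽⁰⁾ ⋊ G` of all `(v, x)` with `v` a unit, is a modular function of `μ` for this
subgroupoid with the Haar system `λ_G^{ρ(v)}`. For a Borel function `q ≥ 0` on `H⁽⁰⁾ ⋊ G`, integrate
`p(a⁻¹) Δ(a⁻¹) q(s(a), y)` over the composable pairs of an arrow `a` of `H ⋊ G` and an arrow
`(s(a), y)` of `H⁽⁰⁾ ⋊ G`. By left invariance of `λ_G` this integral does not change under the flip
`(a, y) ↦ (a y, y⁻¹)`: in the variables `x` and `z = x y`, where `a = (k, x)`, the flip exchanges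
`x` and `z`. Using the modular property of `Δ` before and after the flip, with the multiplicativity
of `Δ` and the invariance of `λ_H` under `G`, gives `∫∫ q(v, y) dλ_G^{ρ(v)}(y) dμ(v)` and
`∫∫ δ(m⁻¹) q(m⁻¹) dλ_G^{ρ(v)}(y) dμ(v)`, with `m = (v, y)`. This is `IsoAction.lintegral_unit_inv`.

Disintegrating `μ` in this identity, and comparing with the modular identity of `Δ_G`, gives
`μ^{s(x)} = δ(·, x⁻¹) Δ_G(x) (x⁻¹ · μ^{r(x)})` for `ν_G`-almost every `x`, since it suffices to
compare the measures on a countable `π`-system (`IsoAction.ae_transports`). The arrows satisfying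
the identity are closed under products (`IsoAction.Transports.mul`), because `Δ` and `Δ_G` are
homomorphisms, and almost every arrow satisfies it together with its inverse. By left invariance,
the set of these arrows contains the reduction to the conull set of all units `u` for which it is
`λ_G^u`-conull (`IsoAction.exists_transports`), and the reduction to a conull set is conull by
quasi-invariance (`IsModularFunction.ae_reduction`).

The product of a groupoid and the action are Borel maps only on closed sets of composable pairs.
They are replaced by total Borel maps, `mulB` and `IsoAction.actB`, which agree with them almost
everywhere for all measures involved.
-/

section

open TopologicalGroupoid
open AlgGroupoid (rng src mul inv)

set_option linter.unusedSectionVars false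

/-! ### Families of Radon measures -/

/-- The mass of an open set is lower semicontinuous in the parameter, by inner regularity and
Urysohn's lemma, and the restrictions to relatively compact open sets are finite measures, which
are determined by the masses of open sets. -/
theorem measurable_of_continuous_integral {X Y : Type*} [TopologicalSpace X] [MeasurableSpace X]
    [OpensMeasurableSpace X] [TopologicalSpace Y] [LocallyCompactSpace Y] [T2Space Y]
    [SecondCountableTopology Y] [MeasurableSpace Y] [BorelSpace Y] (η : X → Measure Y)
    (hfin : ∀ x, IsFiniteMeasureOnCompacts (η x))
    (hcont : ∀ f : Y → ℝ, Continuous f → HasCompactSupport f →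
      Continuous fun x => ∫ y, f y ∂(η x)) : Measurable η := by
  have hopen : ∀ O : Set Y, IsOpen O → Measurable fun x => η x O := by
    intro O hO
    refine LowerSemicontinuous.measurable fun x c hc => ?_
    obtain ⟨C, hCO, hC, hcC⟩ := hO.exists_lt_isCompact hc
    obtain ⟨f, hf1, hfc, hfO, hf01⟩ := exists_continuousMap_one_of_isCompact_subset_isOpen hC hO hCO
    have hint : ∀ x', ENNReal.ofReal (∫ y, f y ∂(η x')) = ∫⁻ y, ENNReal.ofReal (f y) ∂(η x') :=
      fun x' => ofReal_integral_eq_lintegral_ofReal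
        (f.continuous.integrable_of_hasCompactSupport hfc)
        (Filter.Eventually.of_forall fun y => (hf01 y).1)
    have h1 : c < ENNReal.ofReal (∫ y, f y ∂(η x)) := by
      rw [hint]
      refine hcC.trans_le ?_
      rw [← lintegral_indicator_one hC.measurableSet]
      refine lintegral_mono fun y => ?_
      by_cases hy : y ∈ C
      · simp [hy, hf1 hy]
      · simp [hy]
    have h2 : Continuous fun x' => ENNReal.ofReal (∫ y, f y ∂(η x')) :=
      ENNReal.continuous_ofReal.comp (hcont f f.continuous hfc)
    filter_upwards [h2.continuousAt.eventually (lt_mem_nhds h1)] with x' hx'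
    refine hx'.trans_le ?_
    rw [hint, ← lintegral_indicator_one hO.measurableSet]
    refine lintegral_mono fun y => ?_
    by_cases hy : y ∈ O
    · simpa [hy] using (hf01 y).2
    · have : f y = 0 := by
        by_contra h
        exact hy (hfO (subset_tsupport _ h))
      simp [this]
  let K : CompactExhaustion Y := default
  have hV : ∀ n, Measurable fun x => (η x).restrict (interior (K n)) := by
    intro n
    have : ∀ x, IsFiniteMeasure ((η x).restrict (interior (K n))) := fun x =>
      ⟨by
        rw [Measure.restrict_apply_univ]
        exact (measure_mono interior_subset).trans_lt (K.isCompact n).measure_lt_top⟩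
    refine Measurable.measure_of_isPiSystem (S := {O | IsOpen O}) (BorelSpace.measurable_eq)
      isPiSystem_isOpen ?_ ?_
    · intro O hO
      simp_rw [Measure.restrict_apply (IsOpen.measurableSet hO)]
      exact hopen _ (IsOpen.inter hO isOpen_interior)
    · simp_rw [Measure.restrict_apply_univ]
      exact hopen _ isOpen_interior
  refine Measure.measurable_of_measurable_coe _ fun B hB => ?_
  have hmono : Monotone fun n => B ∩ interior (K n) := fun m n h =>
    inter_subset_inter_right _ (interior_mono (K.subset h))
  have hU : B = ⋃ n, B ∩ interior (K n) := by
    rw [← inter_iUnion, eq_comm, inter_eq_left]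
    intro y _
    obtain ⟨n, hn⟩ := K.exists_mem y
    exact mem_iUnion.2 ⟨n + 1, K.subset_interior_succ n hn⟩
  have : (fun x => η x B) = fun x => ⨆ n, (η x).restrict (interior (K n)) B := by
    ext x
    conv_lhs => rw [hU]
    rw [hmono.measure_iUnion]
    simp_rw [Measure.restrict_apply hB]
  rw [this]
  exact Measurable.iSup fun n => (Measure.measurable_coe hB).comp (hV n)

/-- Uniqueness in the Riesz representation theorem, for the image of `m` under a map `T` that is a
homeomorphism onto its image only on a closed set carrying `m`. The left inverse `S` makes the
image measure finite on compact sets. -/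
theorem map_eq_of_integral_eq {Y : Type*} [TopologicalSpace Y] [LocallyCompactSpace Y] [T2Space Y]
    [SecondCountableTopology Y] [MeasurableSpace Y] [BorelSpace Y] {m m' : Measure Y}
    [IsFiniteMeasureOnCompacts m] [IsFiniteMeasureOnCompacts m'] {T S : Y → Y} {F F' : Set Y}
    (hF : IsClosed F) (hF' : IsClosed F') (hm : ∀ᵐ y ∂m, y ∈ F) (hT : ContinuousOn T F)
    (hS : ContinuousOn S F') (hTF : MapsTo T F F') (hST : ∀ y ∈ F, S (T y) = y)
    (h : ∀ f : Y → ℝ, Continuous f → HasCompactSupport f → ∫ y, f (T y) ∂m = ∫ y, f y ∂m') :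
    AEMeasurable T m ∧ m.map T = m' := by
  have hres : m.restrict F = m := Measure.restrict_eq_self_of_ae_mem hm
  have hTm : AEMeasurable T m := by
    rw [← hres]
    exact hT.aemeasurable hF.measurableSet
  refine ⟨hTm, ?_⟩
  have : IsFiniteMeasureOnCompacts (m.map T) := ⟨fun C hC => by
    rw [Measure.map_apply_of_aemeasurable hTm hC.measurableSet]
    have hsub : T ⁻¹' C ∩ F ⊆ S '' (C ∩ F') := fun y hy => ⟨T y, ⟨hy.1, hTF hy.2⟩, hST y hy.2⟩
    calc m (T ⁻¹' C) ≤ m (T ⁻¹' C ∩ F) := measure_mono_ae (by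
            filter_upwards [hm] with y hy h using ⟨h, hy⟩)
      _ ≤ m (S '' (C ∩ F')) := measure_mono hsub
      _ < ∞ := ((hC.inter_right hF').image_of_continuousOn
            (hS.mono inter_subset_right)).measure_lt_top⟩
  refine Measure.ext_of_integral_eq_on_compactlySupported fun f => ?_
  rw [integral_map hTm (f := fun y => f y) f.continuous.aestronglyMeasurable]
  exact h f f.continuous f.hasCompactSupport

/-- The finite intersections of members of a countable generating family. -/
theorem exists_countable_isPiSystem (Y : Type*) [MeasurableSpace Y]
    [MeasurableSpace.CountablyGenerated Y] :
    ∃ C : Set (Set Y), C.Countable ∧ IsPiSystem C ∧ (‹MeasurableSpace Y› = .generateFrom C) := by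
  obtain ⟨b, hb, hgen⟩ := MeasurableSpace.CountablyGenerated.isCountablyGenerated (α := Y)
  refine ⟨sInter '' {F | F.Finite ∧ F ⊆ b}, (countable_ofPred_finite_subset hb).image _, ?_, ?_⟩
  · rintro _ ⟨F, hF, rfl⟩ _ ⟨F', hF', rfl⟩ -
    exact ⟨F ∪ F', ⟨hF.1.union hF'.1, union_subset hF.2 hF'.2⟩, sInter_union F F'⟩
  · apply le_antisymm
    · conv_lhs => rw [hgen]
      refine MeasurableSpace.generateFrom_mono fun s hs => ⟨{s}, ⟨finite_singleton s, ?_⟩, ?_⟩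
      · simpa using hs
      · simp
    · refine MeasurableSpace.generateFrom_le ?_
      rintro _ ⟨F, hF, rfl⟩
      refine MeasurableSet.sInter hF.1.countable fun s hs => ?_
      rw [hgen]
      exact MeasurableSpace.measurableSet_generateFrom (hF.2 hs)

/-! ### Haar systems -/

namespace TopologicalGroupoid

variable {G : Type*} [TopologicalSpace G] [TopologicalGroupoid G]

open AlgGroupoid

theorem continuous_rng : Continuous (rng : G → G) := by
  have : (rng : G → G) = fun x => mul x (inv x) := funext fun x => (mul_inv_eq x).symm
  rw [this]
  exact continuousOn_mul.comp_continuous (continuous_id.prodMk continuous_inv)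
    fun x => (rng_inv x).symm

theorem continuous_src : Continuous (src : G → G) := by
  have : (src : G → G) = fun x => rng (inv x) := funext fun x => (rng_inv x).symm
  rw [this]
  exact continuous_rng.comp continuous_inv

theorem continuous_rngU : Continuous (rngU : G → UnitSpace G) := continuous_rng.subtype_mk _

theorem continuous_srcU : Continuous (srcU : G → UnitSpace G) := continuous_src.subtype_mk _

end TopologicalGroupoid

section Algebra

open AlgGroupoid

variable {G : Type*} [AlgGroupoid G]

theorem rngU_coe (u : UnitSpace G) : rngU (u : G) = u := Subtype.ext u.2

theorem rngU_inv (x : G) : rngU (inv x) = srcU x := Subtype.ext (rng_inv x)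

theorem mul_inv_mul (x y : G) (h : rng x = rng y) : mul x (mul (inv x) y) = y := by
  rw [← mul_mul_eq _ _ _ (rng_inv x).symm (by rw [src_inv, h]), mul_inv_eq, h, rng_mul_self]

theorem inv_mul_rev (x y : G) (h : src x = rng y) : inv (mul x y) = mul (inv y) (inv x) := by
  have hc : src (inv y) = rng (inv x) := by rw [src_inv, rng_inv, h]
  refine (eq_inv_of_mul _ _ ?_ ?_).symm
  · rw [src_mul _ _ h, rng_mul _ _ hc, rng_inv]
  · rw [mul_mul_eq _ _ _ h (by rw [rng_mul _ _ hc, rng_inv]),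
      mul_inv_mul y (inv x) (by rw [rng_inv, h]), mul_inv_eq, rng_mul _ _ h]

end Algebra

namespace IsHaarSystem

variable {G : Type*} [TopologicalSpace G] [LocallyCompactSpace G] [T2Space G]
  [SecondCountableTopology G] [MeasurableSpace G] [BorelSpace G] [TopologicalGroupoid G]
  {lam : UnitSpace G → Measure G}

theorem measurable (hlam : IsHaarSystem lam) : Measurable lam :=
  measurable_of_continuous_integral lam hlam.finite_compacts hlam.continuous_integral

/-- The complement of the support is null by second countability. -/
theorem ae_rngU_eq (hlam : IsHaarSystem lam) (u : UnitSpace G) : ∀ᵐ x ∂(lam u), rngU x = u := by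
  have := Measure.measure_compl_support (μ := lam u)
  rw [hlam.support_eq u] at this
  exact this

theorem ae_rng_eq (hlam : IsHaarSystem lam) (u : UnitSpace G) : ∀ᵐ x ∂(lam u), rng x = (u : G) := by
  filter_upwards [hlam.ae_rngU_eq u] with x hx
  rw [← hx]; rfl

theorem ne_zero (hlam : IsHaarSystem lam) (u : UnitSpace G) : lam u ≠ 0 := by
  intro h
  have h1 : (u : G) ∈ (lam u).support := by
    rw [hlam.support_eq u]; exact rngU_coe u
  rw [h] at h1
  simp at h1

/-- Left invariance as an equality of measures. The map `mul x` is continuous only on the fibre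
over `s(x)`, whence the measurability almost everywhere. -/
theorem map_mul_left (hlam : IsHaarSystem lam) (x : G) :
    AEMeasurable (mul x) (lam (srcU x)) ∧ (lam (srcU x)).map (mul x) = lam (rngU x) := by
  have := hlam.finite_compacts (srcU x)
  have := hlam.finite_compacts (rngU x)
  refine map_eq_of_integral_eq (T := mul x) (S := mul (AlgGroupoid.inv x))
    (F := {y | src x = rng y}) (F' := {y | rng x = rng y})
    (isClosed_eq continuous_const continuous_rng) (isClosed_eq continuous_const continuous_rng)
    ?_ ?_ ?_ ?_ ?_ ?_
  · filter_upwards [hlam.ae_rng_eq (srcU x)] with y hy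
    exact hy.symm
  · exact continuousOn_mul.comp
      (continuous_const.prodMk continuous_id).continuousOn fun y hy => hy
  · exact continuousOn_mul.comp
      (continuous_const.prodMk continuous_id).continuousOn
      fun y hy => (AlgGroupoid.src_inv x).trans hy
  · intro y hy
    exact (AlgGroupoid.rng_mul x y hy).symm
  · intro y hy
    exact AlgGroupoid.inv_mul_mul x y hy
  · intro f hf hfc
    exact hlam.left_invariant f hf hfc x

theorem lintegral_mul_left (hlam : IsHaarSystem lam) (x : G) {f : G → ℝ≥0∞} (hf : Measurable f) :
    ∫⁻ y, f (mul x y) ∂(lam (srcU x)) = ∫⁻ y, f y ∂(lam (rngU x)) := by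
  rw [← (hlam.map_mul_left x).2, lintegral_map' hf.aemeasurable (hlam.map_mul_left x).1]

theorem ae_mul_left (hlam : IsHaarSystem lam) (x : G) {P : G → Prop}
    (h : ∀ᵐ y ∂(lam (rngU x)), P y) :
    ∀ᵐ y ∂(lam (srcU x)), P (mul x y) := by
  rw [← (hlam.map_mul_left x).2] at h
  exact ae_of_ae_map (hlam.map_mul_left x).1 h

/-- A strictly positive function whose integral against every member of the Haar system is `1`:
a convergent weighted sum of indicators of compact sets, normalized on each range fibre. -/
theorem exists_lintegral_eq_one (hlam : IsHaarSystem lam) :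
    ∃ p : G → ℝ≥0∞, Measurable p ∧ (∀ x, p x ≠ 0) ∧ (∀ x, p x ≠ ∞) ∧ ∀ u, ∫⁻ x, p x ∂(lam u) = 1 := by
  let K : CompactExhaustion G := default
  have hK : ∀ n, MeasurableSet (K n) := fun n => (K.isCompact n).measurableSet
  have hfin : ∀ u n, lam u (K n) ≠ ∞ := fun u n => by
    have := hlam.finite_compacts u
    exact (K.isCompact n).measure_lt_top.ne
  obtain ⟨ε, hε0, hε⟩ := ENNReal.exists_pos_sum_of_countable (ε := 1) one_ne_zero ℕ
  -- the weights `w n` make `∑ w n * lam u (K n)` converge, uniformly in `u`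
  let w : ℕ → G → ℝ≥0∞ := fun n x => ε n * (1 + lam (rngU x) (K n))⁻¹
  let q : G → ℝ≥0∞ := fun x => ∑' n, w n x * (K n).indicator 1 x
  have hmu : ∀ n, Measurable fun u => lam u (K n) := fun n =>
    (Measure.measurable_coe (hK n)).comp hlam.measurable
  have hw : ∀ n, Measurable (w n) := fun n =>
    measurable_const.mul (measurable_const.add
      ((hmu n).comp continuous_rngU.measurable)).inv
  have hqn : ∀ n, Measurable fun x => w n x * (K n).indicator 1 x := fun n =>
    (hw n).mul (measurable_one.indicator (hK n))
  have hq : Measurable q := Measurable.tsum hqn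
  have hwpos : ∀ n x, w n x ≠ 0 := fun n x => by
    refine mul_ne_zero (by exact_mod_cast (hε0 n).ne') (ENNReal.inv_ne_zero.2 ?_)
    exact ENNReal.add_ne_top.2 ⟨ENNReal.one_ne_top, hfin _ n⟩
  have hwle : ∀ n x, w n x ≤ ε n := fun n x => by
    refine mul_le_of_le_one_right' (ENNReal.inv_le_one.2 le_self_add)
  have hq0 : ∀ x, q x ≠ 0 := fun x => by
    obtain ⟨n, hn⟩ := K.exists_mem x
    intro h
    have := ENNReal.tsum_eq_zero.1 h n
    simp [hn, hwpos] at this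
  have hqtop : ∀ x, q x ≠ ∞ := fun x => by
    refine ((ENNReal.tsum_le_tsum fun n => ?_).trans_lt (hε.trans ENNReal.one_lt_top)).ne
    refine (mul_le_of_le_one_right' ?_).trans (hwle n x)
    exact indicator_le_self' (by simp) x
  have hI0 : ∀ u, ∫⁻ x, q x ∂(lam u) ≠ 0 := fun u h => by
    rw [lintegral_eq_zero_iff hq] at h
    refine hlam.ne_zero u ?_
    rw [← Measure.measure_univ_eq_zero, ← nonpos_iff_eq_zero]
    refine (measure_mono ?_).trans (le_of_eq (ae_iff.1 h))
    intro x _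
    exact hq0 x
  have hItop : ∀ u, ∫⁻ x, q x ∂(lam u) ≠ ∞ := fun u => by
    refine ne_of_lt ?_
    calc ∫⁻ x, q x ∂(lam u) = ∑' n, ∫⁻ x, w n x * (K n).indicator 1 x ∂(lam u) :=
          lintegral_tsum fun n => (hqn n).aemeasurable
      _ = ∑' n, ε n * (1 + lam u (K n))⁻¹ * lam u (K n) := by
          congr 1
          ext n
          rw [← lintegral_indicator_one (hK n), ← lintegral_const_mul _
            (measurable_one.indicator (hK n))]
          refine lintegral_congr_ae ?_
          filter_upwards [hlam.ae_rngU_eq u] with x hx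
          simp only [w, hx, lintegral_indicator_one (hK n)]
      _ ≤ ∑' n, (ε n : ℝ≥0∞) := by
          refine ENNReal.tsum_le_tsum fun n => ?_
          rw [mul_assoc]
          refine mul_le_of_le_one_right' ?_
          rw [mul_comm, ← div_eq_mul_inv]
          exact ENNReal.div_le_of_le_mul (by rw [one_mul]; exact le_add_self)
      _ < ∞ := hε.trans ENNReal.one_lt_top
  have hIm : Measurable fun u => ∫⁻ x, q x ∂(lam u) :=
    (Measure.measurable_lintegral hq).comp hlam.measurable
  refine ⟨fun x => q x * (∫⁻ y, q y ∂(lam (rngU x)))⁻¹,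
    hq.mul (hIm.comp continuous_rngU.measurable).inv,
    fun x => mul_ne_zero (hq0 x) (ENNReal.inv_ne_zero.2 (hItop _)),
    fun x => ENNReal.mul_ne_top (hqtop x) (ENNReal.inv_ne_top.2 (hI0 _)), fun u => ?_⟩
  calc ∫⁻ x, q x * (∫⁻ y, q y ∂(lam (rngU x)))⁻¹ ∂(lam u)
      = ∫⁻ x, q x * (∫⁻ y, q y ∂(lam u))⁻¹ ∂(lam u) := by
        refine lintegral_congr_ae ?_
        filter_upwards [hlam.ae_rngU_eq u] with x hx
        simp only [hx]
    _ = 1 := by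
        rw [lintegral_mul_const _ hq, ENNReal.mul_inv_cancel (hI0 u) (hItop u)]

end IsHaarSystem

/-! ### The Haar system as a kernel -/

namespace IsHaarSystem

variable {G : Type*} [TopologicalSpace G] [LocallyCompactSpace G] [T2Space G]
  [SecondCountableTopology G] [MeasurableSpace G] [BorelSpace G] [TopologicalGroupoid G]
  {lam : UnitSpace G → Measure G}

/-- A Haar system, as a kernel from the unit space to the groupoid. -/
noncomputable def kernel (hlam : IsHaarSystem lam) : Kernel (UnitSpace G) G := ⟨lam, hlam.measurable⟩

/-- The kernel has an everywhere finite density with respect to a kernel of probability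
measures. -/
instance isSFiniteKernel_kernel (hlam : IsHaarSystem lam) : IsSFiniteKernel hlam.kernel := by
  obtain ⟨p, hp, hp0, hptop, hp1⟩ := hlam.exists_lintegral_eq_one
  let η : Kernel (UnitSpace G) G := ⟨fun u => (lam u).withDensity p, by
    refine Measure.measurable_of_measurable_coe _ fun B hB => ?_
    simp_rw [withDensity_apply _ hB, ← lintegral_indicator hB]
    exact (Measure.measurable_lintegral (hp.indicator hB)).comp hlam.measurable⟩
  have hη : IsFiniteKernel η := ⟨1, ENNReal.one_lt_top, fun u => by
    show (lam u).withDensity p univ ≤ 1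
    rw [withDensity_apply _ MeasurableSet.univ, setLIntegral_univ, hp1]⟩
  have : hlam.kernel = η.withDensity fun _ x => (p x)⁻¹ := by
    ext1 u
    rw [Kernel.withDensity_apply (f := fun _ x => (p x)⁻¹) η (hp.inv.comp measurable_snd)]
    exact (withDensity_inv_same hp (Filter.Eventually.of_forall hp0)
      (Filter.Eventually.of_forall hptop)).symm
  rw [this]
  exact Kernel.IsSFiniteKernel.withDensity _ fun _ x => ENNReal.inv_ne_top.2 (hp0 x)

theorem sFinite (hlam : IsHaarSystem lam) (u : UnitSpace G) : SFinite (lam u) :=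
  inferInstanceAs (SFinite (hlam.kernel u))

end IsHaarSystem

/-! ### Borel extensions of partially defined operations -/

section Total

open Classical in
/-- The product, redefined on pairs that are not composable so as to be a Borel map. -/
noncomputable def mulB {G : Type*} [AlgGroupoid G] (x y : G) : G := if src x = rng y then mul x y else x

theorem mulB_eq {G : Type*} [AlgGroupoid G] {x y : G} (h : src x = rng y) :
    mulB x y = mul x y := if_pos h

theorem measurable_mulB {G : Type*} [TopologicalSpace G] [T2Space G]
    [SecondCountableTopology G] [MeasurableSpace G] [BorelSpace G] [TopologicalGroupoid G] :
    Measurable fun p : G × G => mulB p.1 p.2 := by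
  classical
  have hc : IsClosed {p : G × G | src p.1 = rng p.2} :=
    isClosed_eq (continuous_src.comp continuous_fst) (continuous_rng.comp continuous_snd)
  have := ContinuousOn.measurable_piecewise (f := fun p : G × G => mul p.1 p.2)
    (g := fun p : G × G => p.1) (s := {p : G × G | src p.1 = rng p.2})
    TopologicalGroupoid.continuousOn_mul continuous_fst.continuousOn hc.measurableSet
  exact this

end Total

namespace IsoAction

open AlgGroupoid (rng_inv src_inv rng_src src_rng rng_rng src_src inv_inv_eq)

variable {G H : Type*}
  [TopologicalSpace G] [LocallyCompactSpace G] [T2Space G] [SecondCountableTopology G]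
  [MeasurableSpace G] [BorelSpace G] [TopologicalGroupoid G]
  [TopologicalSpace H] [LocallyCompactSpace H] [T2Space H] [SecondCountableTopology H]
  [MeasurableSpace H] [BorelSpace H] [TopologicalGroupoid H]
  (A : IsoAction G H)

open Classical in
/-- The action, redefined where the source does not match the moment so as to be a Borel map. -/
noncomputable def actB (x : G) (h : H) : H := if src x = (A.moment h : G) then A.act x h else h

/-- The action on units, redefined where the source does not match the moment so as to be a
Borel map. -/
noncomputable def actUB (x : G) (v : UnitSpace H) : UnitSpace H := rngU (A.actB x v.1)

/-- The inversion `(h, x)⁻¹ = (x⁻¹ · h⁻¹, x⁻¹)` of the semidirect product, extended to a Borel map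
on the whole product space. -/
noncomputable def invB (a : H × G) : H × G := (A.actB (inv a.2) (inv a.1), inv a.2)

open Classical in
/-- The modular function, with values in `[0, ∞]` and extended by `0` to the whole product
space. -/
noncomputable def modularExt (Δ : A.Semidirect → ℝ) (a : H × G) : ℝ≥0∞ :=
  if h : (A.moment a.1 : G) = rng a.2 then ENNReal.ofReal (Δ ⟨a, h⟩) else 0

theorem actB_eq {x : G} {h : H} (hx : src x = (A.moment h : G)) : A.actB x h = A.act x h :=
  if_pos hx

theorem actUB_eq {x : G} {v : UnitSpace H} (hx : src x = (A.momentU v : G)) :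
    A.actUB x v = A.actU x v := by
  unfold actUB actU
  rw [A.actB_eq hx]

theorem continuous_moment_coe : Continuous fun h : H => (A.moment h : G) :=
  continuous_subtype_val.comp A.continuous_moment

theorem continuous_momentU : Continuous A.momentU :=
  A.continuous_moment.comp continuous_subtype_val

theorem measurable_momentU : Measurable A.momentU := A.continuous_momentU.measurable

theorem measurable_actB : Measurable fun p : G × H => A.actB p.1 p.2 := by
  classical
  have hc : IsClosed {p : G × H | src p.1 = (A.moment p.2 : G)} :=
    isClosed_eq (continuous_src.comp continuous_fst) (A.continuous_moment_coe.comp continuous_snd)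
  have := ContinuousOn.measurable_piecewise (f := fun p : G × H => A.act p.1 p.2)
    (g := fun p : G × H => p.2) (s := {p : G × H | src p.1 = (A.moment p.2 : G)})
    A.continuousOn_act continuous_snd.continuousOn hc.measurableSet
  exact this

theorem measurable_actUB : Measurable fun p : G × UnitSpace H => A.actUB p.1 p.2 :=
  continuous_rngU.measurable.comp (A.measurable_actB.comp
    (measurable_fst.prodMk (measurable_subtype_coe.comp measurable_snd)))

theorem measurable_invB : Measurable A.invB :=
  (A.measurable_actB.comp ((TopologicalGroupoid.continuous_inv.measurable.comp measurable_snd).prodMk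
    (TopologicalGroupoid.continuous_inv.measurable.comp measurable_fst))).prodMk
    (TopologicalGroupoid.continuous_inv.measurable.comp measurable_snd)

theorem measurableSet_compatible : MeasurableSet {a : H × G | (A.moment a.1 : G) = rng a.2} :=
  (isClosed_eq (A.continuous_moment_coe.comp continuous_fst)
    (continuous_rng.comp continuous_snd)).measurableSet

theorem measurable_modularExt {Δ : A.Semidirect → ℝ} (hΔ : Measurable Δ) :
    Measurable (A.modularExt Δ) := by
  classical
  exact Measurable.dite (f := fun a : {a : H × G | (A.moment a.1 : G) = rng a.2} =>
    ENNReal.ofReal (Δ ⟨a.1, a.2⟩)) (g := fun _ => 0) (ENNReal.measurable_ofReal.comp hΔ)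
    measurable_const A.measurableSet_compatible

theorem modularExt_eq (Δ : A.Semidirect → ℝ) (p : A.Semidirect) :
    A.modularExt Δ p.1 = ENNReal.ofReal (Δ p) := dif_pos p.2

theorem ofReal_unitRestriction (Δ : A.Semidirect → ℝ) (v : UnitSpace H) (x : G) :
    ENNReal.ofReal (A.unitRestriction Δ v x) = A.modularExt Δ (v.1, x) := by
  unfold unitRestriction
  by_cases h : (A.momentU v : G) = rng x
  · rw [dif_pos h]
    exact (A.modularExt_eq Δ ⟨(v.1, x), h⟩).symm
  · rw [dif_neg h, ENNReal.ofReal_zero]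
    exact (dif_neg h : A.modularExt Δ (v.1, x) = 0).symm

theorem modularExt_mul {lam : UnitSpace A.Semidirect → Measure A.Semidirect}
    {m : Measure (UnitSpace A.Semidirect)} {Δ : A.Semidirect → ℝ}
    (hΔ : IsModularFunction lam m Δ) {k h : H} {x y : G}
    (hk : (A.moment k : G) = rng x) (hxy : src x = rng y) (hkh : src k = A.act x (rng h))
    (hh : (A.moment h : G) = rng y) :
    A.modularExt Δ (mul k (A.act x h), mul x y)
      = A.modularExt Δ (k, x) * A.modularExt Δ (h, y) := by
  let p : A.Semidirect := ⟨(k, x), hk⟩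
  let q : A.Semidirect := ⟨(h, y), hh⟩
  have hpq : Semidirect.src' p = Semidirect.rng' q := (Semidirect.comp_iff p q).2 ⟨hxy, hkh⟩
  have h1 := A.modularExt_eq Δ (Semidirect.mulOf p q hpq)
  have h2 : Δ (Semidirect.mulOf p q hpq) = Δ p * Δ q := by
    rw [← Semidirect.mul'_eq hpq]
    exact hΔ.map_mul p q hpq
  rw [h2, ENNReal.ofReal_mul (hΔ.pos p).le, ← A.modularExt_eq, ← A.modularExt_eq] at h1
  exact h1

theorem moment_act_inv {x : G} {k : H} (hk : (A.moment k : G) = rng x) :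
    (A.moment (A.act (inv x) k) : G) = src x := by
  rw [A.moment_act _ _ (by rw [src_inv, hk]), rng_inv]

theorem invB_eq {k : H} {x : G} (hk : (A.moment k : G) = rng x) :
    A.invB (k, x) = (A.act (inv x) (inv k), inv x) := by
  unfold invB
  rw [A.actB_eq]
  show src (inv x) = (A.moment (inv k) : G)
  rw [A.moment_inv, src_inv, hk]

theorem coe_semidirect_inv (p : A.Semidirect) : (inv p : A.Semidirect).1 = A.invB p.1 :=
  (A.invB_eq p.2).symm

variable {lamG : UnitSpace G → Measure G} {lamH : UnitSpace H → Measure H}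

/-- The Haar system `λ_H^v × λ_G^{ρ(v)}` of the semidirect product, as a kernel from the unit space
of `H` to the whole product space. -/
noncomputable def prodKernel (hlamH : IsHaarSystem lamH) (hlamG : IsHaarSystem lamG) :
    Kernel (UnitSpace H) (H × G) :=
  hlamH.kernel.prod (hlamG.kernel.comap A.momentU A.measurable_momentU)

instance (hlamH : IsHaarSystem lamH) (hlamG : IsHaarSystem lamG) :
    IsSFiniteKernel (A.prodKernel hlamH hlamG) := by
  unfold prodKernel
  infer_instance

theorem prodKernel_apply (hlamH : IsHaarSystem lamH) (hlamG : IsHaarSystem lamG)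
    (v : UnitSpace H) :
    A.prodKernel hlamH hlamG v = (lamH v).prod (lamG (A.momentU v)) := by
  unfold prodKernel
  rw [Kernel.prod_apply]
  rfl

theorem lintegral_prodKernel (hlamH : IsHaarSystem lamH) (hlamG : IsHaarSystem lamG)
    (v : UnitSpace H) {f : H × G → ℝ≥0∞} (hf : Measurable f) :
    ∫⁻ a, f a ∂(A.prodKernel hlamH hlamG v)
      = ∫⁻ k, ∫⁻ x, f (k, x) ∂(lamG (A.momentU v)) ∂(lamH v) := by
  rw [prodKernel_apply]
  have := hlamG.sFinite (A.momentU v)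
  exact lintegral_prod _ hf.aemeasurable

theorem ae_prodKernel (hlamH : IsHaarSystem lamH) (hlamG : IsHaarSystem lamG)
    (v : UnitSpace H) :
    ∀ᵐ a ∂(A.prodKernel hlamH hlamG v), rng a.1 = (v : H) ∧ rng a.2 = (A.momentU v : G) := by
  rw [prodKernel_apply]
  have := hlamG.sFinite (A.momentU v)
  have hm : MeasurableSet {a : H × G | rng a.1 = (v : H) ∧ rng a.2 = (A.momentU v : G)} :=
    ((isClosed_eq (continuous_rng.comp continuous_fst) continuous_const).inter
      (isClosed_eq (continuous_rng.comp continuous_snd) continuous_const)).measurableSet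
  rw [Measure.ae_prod_iff_ae_ae hm]
  filter_upwards [hlamH.ae_rng_eq v] with k hk
  filter_upwards [hlamG.ae_rng_eq (A.momentU v)] with x hx
  exact ⟨hk, hx⟩

theorem moment_eq_rng {v : UnitSpace H} {a : H × G}
    (ha : rng a.1 = (v : H) ∧ rng a.2 = (A.momentU v : G)) : (A.moment a.1 : G) = rng a.2 := by
  rw [ha.2, ← A.moment_rng, ha.1]
  rfl

/-- The product measure is carried by the compatible pairs, so that nothing is lost in passing from
the subtype to the whole product space. -/
theorem lintegral_semidirectHaar (hlamH : IsHaarSystem lamH) (hlamG : IsHaarSystem lamG)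
    (v : UnitSpace H) (f : H × G → ℝ≥0∞) :
    ∫⁻ p, f p.1 ∂(A.semidirectHaar lamH lamG (A.semidirectUnit v))
      = ∫⁻ a, f a ∂(A.prodKernel hlamH hlamG v) := by
  have he : MeasurableEmbedding
      (Subtype.val : {a : H × G | (A.moment a.1 : G) = rng a.2} → H × G) :=
    MeasurableEmbedding.subtype_coe A.measurableSet_compatible
  have h1 : A.semidirectHaar lamH lamG (A.semidirectUnit v)
      = (A.prodKernel hlamH hlamG v).comap
        (Subtype.val : {a : H × G | (A.moment a.1 : G) = rng a.2} → H × G) := by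
    rw [prodKernel_apply]
    show ((lamH (rngU v.1)).prod (lamG (rngU (A.momentU v).1))).comap _ = _
    rw [rngU_coe, rngU_coe]
    rfl
  rw [h1]
  refine (he.lintegral_map f).symm.trans ?_
  rw [he.map_comap, Subtype.range_val, Measure.restrict_eq_self_of_ae_mem]
  filter_upwards [A.ae_prodKernel hlamH hlamG v] with a ha
  exact A.moment_eq_rng ha

theorem measurableEmbedding_semidirectUnit : MeasurableEmbedding A.semidirectUnit := by
  let e : UnitSpace H ≃ᵐ UnitSpace A.Semidirect :=
    { toFun := A.semidirectUnit
      invFun := fun p => rngU p.1.1.1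
      left_inv := fun v => rngU_coe v
      right_inv := fun p => by
        have h1 : rng p.1.1.1 = p.1.1.1 := congrArg (fun q : A.Semidirect => q.1.1) p.2
        have h2 : rng p.1.1.2 = p.1.1.2 := congrArg (fun q : A.Semidirect => q.1.2) p.2
        refine Subtype.ext (Semidirect.ext' h1 ?_)
        show (A.moment (rng p.1.1.1) : G) = p.1.1.2
        rw [h1, p.1.2, h2]
      measurable_toFun := by
        refine Measurable.subtype_mk (Measurable.subtype_mk ?_)
        exact measurable_subtype_coe.prodMk (measurable_subtype_coe.comp A.measurable_momentU)
      measurable_invFun := continuous_rngU.measurable.comp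
        (measurable_fst.comp (measurable_subtype_coe.comp measurable_subtype_coe)) }
  exact e.measurableEmbedding

/-- The defining property of the modular function of the semidirect product, in terms of functions
on the whole product space. -/
theorem lintegral_invB (hlamH : IsHaarSystem lamH) (hlamG : IsHaarSystem lamG)
    {μ : Measure (UnitSpace H)} {Δ : A.Semidirect → ℝ}
    (hΔ : IsModularFunction (A.semidirectHaar lamH lamG) (μ.map A.semidirectUnit) Δ)
    {f : H × G → ℝ≥0∞} (hf : Measurable f) :
    ∫⁻ v, ∫⁻ a, f (A.invB a) * A.modularExt Δ (A.invB a) ∂(A.prodKernel hlamH hlamG v) ∂μ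
      = ∫⁻ v, ∫⁻ a, f a ∂(A.prodKernel hlamH hlamG v) ∂μ := by
  have h := hΔ.lintegral_inv (fun p => f p.1) (hf.comp measurable_subtype_coe)
  rw [A.measurableEmbedding_semidirectUnit.lintegral_map,
    A.measurableEmbedding_semidirectUnit.lintegral_map] at h
  simp_rw [A.lintegral_semidirectHaar hlamH hlamG] at h
  rw [← h]
  refine lintegral_congr fun v => ?_
  rw [← A.lintegral_semidirectHaar hlamH hlamG]
  refine lintegral_congr fun p => ?_
  rw [← A.coe_semidirect_inv, A.modularExt_eq]

/-- Invariance of the Haar system of `H`, for Borel functions. -/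
theorem lintegral_act (hlamH : IsHaarSystem lamH) (hinv : A.IsInvariant lamH) {x : G}
    {v : UnitSpace H} (hx : src x = (A.momentU v : G)) {f : H → ℝ≥0∞} (hf : Measurable f) :
    ∫⁻ h, f (A.act x h) ∂(lamH v) = ∫⁻ h, f h ∂(lamH (A.actU x v)) := by
  have := hlamH.finite_compacts v
  have := hlamH.finite_compacts (A.actU x v)
  have hc : ∀ y : G, ContinuousOn (A.act y) {h | src y = (A.moment h : G)} := fun y =>
    A.continuousOn_act.comp (continuous_const.prodMk continuous_id).continuousOn fun h hh => hh
  obtain ⟨h1, h2⟩ := map_eq_of_integral_eq (T := A.act x) (S := A.act (inv x))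
    (F := {h | src x = (A.moment h : G)}) (F' := {h | src (inv x) = (A.moment h : G)})
    (m := lamH v) (m' := lamH (A.actU x v))
    (isClosed_eq continuous_const A.continuous_moment_coe)
    (isClosed_eq continuous_const A.continuous_moment_coe)
    (by
      filter_upwards [hlamH.ae_rng_eq v] with h hh
      show src x = (A.moment h : G)
      rw [← A.moment_rng, hh, hx]
      rfl)
    (hc x) (hc _)
    (fun h hh => by
      show src (inv x) = (A.moment (A.act x h) : G)
      rw [A.moment_act _ _ hh, src_inv])
    (fun h hh => A.act_inv_act x h hh)
    (fun f hf hfc => hinv f hf hfc x v hx)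
  rw [← h2, lintegral_map' hf.aemeasurable h1]

/-! ### Restricting the modular function to units -/

/-- For an arrow `a = (k, x)` and `z` with `r(z) = r(x)`, the function
`p(a⁻¹) Δ(a⁻¹) q(s(a), x⁻¹ z)`, where `q` is a function of the arrows of `H⁽⁰⁾ ⋊ G`. -/
noncomputable def flipIntegrand (Δ : A.Semidirect → ℝ) (p : H × G → ℝ≥0∞)
    (q : UnitSpace H × G → ℝ≥0∞) (k : H) (x z : G) : ℝ≥0∞ :=
  p (A.invB (k, x)) * A.modularExt Δ (A.invB (k, x))
    * q (A.actUB (inv x) (srcU k), mulB (inv x) z)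

theorem measurable_flipIntegrand {Δ : A.Semidirect → ℝ} (hΔ : Measurable Δ)
    {p : H × G → ℝ≥0∞} (hp : Measurable p) {q : UnitSpace H × G → ℝ≥0∞} (hq : Measurable q) :
    Measurable fun t : H × G × G => A.flipIntegrand Δ p q t.1 t.2.1 t.2.2 := by
  have hi : Measurable (inv : G → G) := TopologicalGroupoid.continuous_inv.measurable
  have h1 : Measurable fun t : H × G × G => A.invB (t.1, t.2.1) :=
    A.measurable_invB.comp (measurable_fst.prodMk (measurable_fst.comp measurable_snd))
  have h2 : Measurable fun t : H × G × G => inv t.2.1 :=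
    hi.comp (measurable_fst.comp measurable_snd)
  have h3 : Measurable fun t : H × G × G => A.actUB (inv t.2.1) (srcU t.1) :=
    A.measurable_actUB.comp (h2.prodMk (continuous_srcU.measurable.comp measurable_fst))
  have h4 : Measurable fun t : H × G × G => mulB (inv t.2.1) t.2.2 :=
    measurable_mulB.comp (h2.prodMk (measurable_snd.comp measurable_snd))
  exact ((hp.comp h1).mul ((A.measurable_modularExt hΔ).comp h1)).mul (hq.comp (h3.prodMk h4))

theorem rngU_invB {k : H} {x : G} (hk : (A.moment k : G) = rng x) :
    rngU (A.invB (k, x)).1 = A.actUB (inv x) (srcU k) := by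
  rw [A.invB_eq hk, A.actUB_eq]
  · refine Subtype.ext ?_
    show rng (A.act (inv x) (inv k)) = rng (A.act (inv x) (src k))
    have h1 : src (inv x) = (A.moment (inv k) : G) := by rw [A.moment_inv, src_inv, hk]
    have h2 : src (inv x) = (A.moment (src k) : G) := by rw [A.moment_src, src_inv, hk]
    rw [← A.act_rng _ _ h1, ← A.act_rng _ _ h2, rng_inv, rng_src]
  · show src (inv x) = (A.moment (src k) : G)
    rw [A.moment_src, src_inv, hk]

theorem momentU_rngU (k : H) : A.momentU (rngU k) = A.moment k := A.moment_rng k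

theorem momentU_rngU_invB {k : H} {x : G} (hk : (A.moment k : G) = rng x) :
    A.momentU (rngU (A.invB (k, x)).1) = srcU x := by
  rw [momentU_rngU, A.invB_eq hk]
  refine Subtype.ext ?_
  show (A.moment (A.act (inv x) (inv k)) : G) = src x
  exact A.moment_act_inv (by rw [A.moment_inv, hk])

/-- Integrating `flipIntegrand` over the last variable: the substitution `z = x y` leaves the Haar
integral of `q(s(a), ·)`, and `s(a) = r(a⁻¹)`. -/
theorem lintegral_flipIntegrand_right (hlamG : IsHaarSystem lamG) {Δ : A.Semidirect → ℝ}
    {p : H × G → ℝ≥0∞} {q : UnitSpace H × G → ℝ≥0∞} (hΔ : Measurable Δ) (hp : Measurable p)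
    (hq : Measurable q) {k : H} {x : G} (hk : (A.moment k : G) = rng x) :
    ∫⁻ z, A.flipIntegrand Δ p q k x z ∂(lamG (rngU x))
      = p (A.invB (k, x)) * (∫⁻ y, q (rngU (A.invB (k, x)).1, y)
          ∂(lamG (A.momentU (rngU (A.invB (k, x)).1)))) * A.modularExt Δ (A.invB (k, x)) := by
  have hm : Measurable fun z => A.flipIntegrand Δ p q k x z :=
    (A.measurable_flipIntegrand hΔ hp hq).comp
      (measurable_const.prodMk (measurable_const.prodMk measurable_id))
  rw [A.momentU_rngU_invB hk, ← hlamG.lintegral_mul_left x hm, A.rngU_invB hk]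
  have : ∀ᵐ y ∂(lamG (srcU x)), A.flipIntegrand Δ p q k x (mul x y)
      = p (A.invB (k, x)) * A.modularExt Δ (A.invB (k, x))
        * q (A.actUB (inv x) (srcU k), y) := by
    filter_upwards [hlamG.ae_rng_eq (srcU x)] with y hy
    have hy' : src x = rng y := hy.symm
    unfold flipIntegrand
    rw [mulB_eq (by rw [src_inv, AlgGroupoid.rng_mul _ _ hy']),
      AlgGroupoid.inv_mul_mul _ _ hy']
  have hqm : Measurable fun y => q (A.actUB (inv x) (srcU k), y) :=
    hq.comp (measurable_const.prodMk measurable_id)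
  rw [lintegral_congr_ae this, lintegral_const_mul _ hqm]
  ring

/-- The function of an arrow `b` obtained by integrating `p(m⁻¹ b) Δ(m⁻¹) q(m⁻¹)` over the arrows
`m = (r(b), y)` of `H⁽⁰⁾ ⋊ G`. -/
noncomputable def convolve (lamG : UnitSpace G → Measure G) (Δ : A.Semidirect → ℝ) (p : H × G → ℝ≥0∞)
    (q : UnitSpace H × G → ℝ≥0∞) (b : H × G) : ℝ≥0∞ :=
  ∫⁻ y, p (A.actB (inv y) b.1, mulB (inv y) b.2)
    * (A.modularExt Δ ((A.actUB (inv y) (rngU b.1)).1, inv y)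
      * q (A.actUB (inv y) (rngU b.1), inv y)) ∂(lamG (A.momentU (rngU b.1)))

/-- Integrating `flipIntegrand` over the first variable in `G`: by left invariance, this is the
integral over `y` of the value at `x y`, and `(k, x y) = (k, x) (x⁻¹ · s(k), y)`. -/
theorem lintegral_flipIntegrand_left (hlamG : IsHaarSystem lamG)
    {l : UnitSpace A.Semidirect → Measure A.Semidirect} {m : Measure (UnitSpace A.Semidirect)}
    {Δ : A.Semidirect → ℝ} (hΔ : IsModularFunction l m Δ)
    {p : H × G → ℝ≥0∞} {q : UnitSpace H × G → ℝ≥0∞} (hp : Measurable p)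
    (hq : Measurable q) {k : H} {x : G} (hk : (A.moment k : G) = rng x) :
    ∫⁻ z, A.flipIntegrand Δ p q k z x ∂(lamG (rngU x))
      = A.convolve lamG Δ p q (A.invB (k, x)) * A.modularExt Δ (A.invB (k, x)) := by
  have hm : Measurable fun z => A.flipIntegrand Δ p q k z x :=
    (A.measurable_flipIntegrand hΔ.measurable hp hq).comp
      (measurable_const.prodMk (measurable_id.prodMk measurable_const))
  have htop : A.modularExt Δ (A.invB (k, x)) ≠ ∞ := by
    unfold modularExt
    split_ifs <;> simp
  unfold convolve
  rw [A.momentU_rngU_invB hk, ← hlamG.lintegral_mul_left x hm, ← lintegral_mul_const' _ _ htop]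
  refine lintegral_congr_ae ?_
  filter_upwards [hlamG.ae_rng_eq (srcU x)] with y hy
  have hy' : src x = rng y := hy.symm
  have hkxy : (A.moment k : G) = rng (mul x y) := by rw [AlgGroupoid.rng_mul _ _ hy', hk]
  have hixy : inv (mul x y) = mul (inv y) (inv x) := inv_mul_rev x y hy'
  have hc1 : src (inv y) = rng (inv x) := by rw [src_inv, rng_inv, hy']
  have hki : src (inv x) = (A.moment (inv k) : G) := by rw [A.moment_inv, src_inv, hk]
  have hks : src (inv x) = (A.moment (src k) : G) := by rw [A.moment_src, src_inv, hk]
  -- the arrow `b = (k, x)⁻¹`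
  have hb : A.invB (k, x) = (A.act (inv x) (inv k), inv x) := A.invB_eq hk
  have hbm : (A.moment (A.act (inv x) (inv k)) : G) = src x :=
    A.moment_act_inv (by rw [A.moment_inv, hk])
  have hym : src (inv y) = (A.moment (A.act (inv x) (inv k)) : G) := by
    rw [src_inv, hbm, hy']
  -- the arrow `m⁻¹ b = (k, x y)⁻¹`
  have hmb : A.invB (k, mul x y)
      = (A.act (inv y) (A.act (inv x) (inv k)), mul (inv y) (inv x)) := by
    rw [A.invB_eq hkxy, hixy, A.act_act _ _ _ hc1 hki]
  have hw : A.actUB (inv y) (rngU (A.act (inv x) (inv k)))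
      = A.actUB (inv (mul x y)) (srcU k) := by
    rw [← A.rngU_invB hkxy, hmb, A.actUB_eq (by
      show src (inv y) = (A.moment (rng (A.act (inv x) (inv k))) : G)
      rw [A.moment_rng, hym])]
    refine Subtype.ext ?_
    show rng (A.act (inv y) (rng (A.act (inv x) (inv k)))) = rng (A.act (inv y) _)
    rw [A.act_rng _ _ hym, rng_rng]
  have hmx : mulB (inv (mul x y)) x = inv y := by
    rw [mulB_eq (by rw [src_inv, AlgGroupoid.rng_mul _ _ hy']), hixy,
      AlgGroupoid.mul_mul_eq _ _ _ hc1 (src_inv x), AlgGroupoid.inv_mul_eq, hy', ← src_inv y,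
      AlgGroupoid.mul_src_self]
  have hwcoe : (A.actUB (inv y) (rngU (A.act (inv x) (inv k)))).1
      = rng (A.act (inv y) (A.act (inv x) (inv k))) := by
    rw [hw, ← A.rngU_invB hkxy, hmb]
    rfl
  -- multiplicativity along `m⁻¹ b`
  have hmul : A.modularExt Δ (A.invB (k, mul x y))
      = A.modularExt Δ ((A.actUB (inv y) (rngU (A.act (inv x) (inv k)))).1, inv y)
        * A.modularExt Δ (A.act (inv x) (inv k), inv x) := by
    rw [hmb, hwcoe, ← A.modularExt_mul hΔ (k := rng (A.act (inv y) (A.act (inv x) (inv k))))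
      (h := A.act (inv x) (inv k)) (x := inv y) (y := inv x) ?_ hc1 ?_ ?_,
      AlgGroupoid.rng_mul_self]
    · rw [A.moment_rng, A.moment_act _ _ hym]
    · rw [src_rng, A.act_rng _ _ hym]
    · rw [hbm, rng_inv]
  unfold flipIntegrand
  rw [hmx, hmul, ← hw, hb, A.actB_eq hym, mulB_eq hc1, ← hmb]
  ring

theorem measurable_convolve (hlamG : IsHaarSystem lamG) {Δ : A.Semidirect → ℝ}
    (hΔ : Measurable Δ) {p : H × G → ℝ≥0∞} {q : UnitSpace H × G → ℝ≥0∞} (hp : Measurable p)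
    (hq : Measurable q) : Measurable (A.convolve lamG Δ p q) := by
  have hr : Measurable fun b : H × G => A.momentU (rngU b.1) :=
    A.measurable_momentU.comp (continuous_rngU.measurable.comp measurable_fst)
  have hi : Measurable (inv : G → G) := TopologicalGroupoid.continuous_inv.measurable
  have h1 : Measurable fun t : (H × G) × G => inv t.2 := hi.comp measurable_snd
  have h2 : Measurable fun t : (H × G) × G => (A.actB (inv t.2) t.1.1, mulB (inv t.2) t.1.2) :=
    (A.measurable_actB.comp (h1.prodMk (measurable_fst.comp measurable_fst))).prodMk
      (measurable_mulB.comp (h1.prodMk (measurable_snd.comp measurable_fst)))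
  have h3 : Measurable fun t : (H × G) × G => A.actUB (inv t.2) (rngU t.1.1) :=
    A.measurable_actUB.comp (h1.prodMk
      (continuous_rngU.measurable.comp (measurable_fst.comp measurable_fst)))
  have h4 : Measurable fun t : (H × G) × G => p (A.actB (inv t.2) t.1.1, mulB (inv t.2) t.1.2)
      * (A.modularExt Δ ((A.actUB (inv t.2) (rngU t.1.1)).1, inv t.2)
        * q (A.actUB (inv t.2) (rngU t.1.1), inv t.2)) :=
    (hp.comp h2).mul (((A.measurable_modularExt hΔ).comp
      ((measurable_subtype_coe.comp h3).prodMk h1)).mul (hq.comp (h3.prodMk h1)))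
  exact h4.lintegral_kernel_prod_right' (κ := hlamG.kernel.comap _ hr)

theorem coe_momentU_actUB {x : G} {v : UnitSpace H} (hx : src x = (A.momentU v : G)) :
    (A.momentU (A.actUB x v) : G) = rng x := by
  rw [A.actUB_eq hx]
  show (A.moment (rng (A.act x v.1)) : G) = rng x
  rw [A.moment_rng, A.moment_act _ _ hx]

/-- Left translation by an arrow `(y · v, y)` of `H⁽⁰⁾ ⋊ G` preserves the Haar system of the
semidirect product. -/
theorem lintegral_prodKernel_act (hlamH : IsHaarSystem lamH) (hlamG : IsHaarSystem lamG)
    (hinv : A.IsInvariant lamH) {y : G} {v : UnitSpace H} (hy : src y = (A.momentU v : G))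
    {p : H × G → ℝ≥0∞} (hp : Measurable p) :
    ∫⁻ a, p (A.actB y a.1, mulB y a.2) ∂(A.prodKernel hlamH hlamG v)
      = ∫⁻ a, p a ∂(A.prodKernel hlamH hlamG (A.actUB y v)) := by
  have hm : Measurable fun a : H × G => p (A.actB y a.1, mulB y a.2) :=
    hp.comp ((A.measurable_actB.comp (measurable_const.prodMk measurable_fst)).prodMk
      (measurable_mulB.comp (measurable_const.prodMk measurable_snd)))
  have hs : A.momentU v = srcU y := Subtype.ext hy.symm
  have hr : A.momentU (A.actUB y v) = rngU y := Subtype.ext (A.coe_momentU_actUB hy)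
  have := hlamG.sFinite (rngU y)
  rw [A.lintegral_prodKernel _ _ _ hm, A.lintegral_prodKernel _ _ _ hp, hs, hr,
    A.actUB_eq hy, ← A.lintegral_act hlamH hinv hy hp.lintegral_prod_right']
  refine lintegral_congr_ae ?_
  filter_upwards [hlamH.ae_rng_eq v] with k hk
  have hyk : src y = (A.moment k : G) := by
    rw [hy, ← A.moment_rng k, hk]
    rfl
  have hpm : Measurable fun z => p (A.act y k, z) :=
    hp.comp (measurable_const.prodMk measurable_id)
  rw [← hlamG.lintegral_mul_left y hpm]
  refine lintegral_congr_ae ?_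
  filter_upwards [hlamG.ae_rng_eq (srcU y)] with x hx
  rw [A.actB_eq hyk, mulB_eq hx.symm]

/-- The restriction of the modular function of `H ⋊ G` to the closed subgroupoid `H⁽⁰⁾ ⋊ G` is a
modular function of `μ` for that subgroupoid. With `p ≥ 0` of integral `1` over each range fibre of
`H ⋊ G`, consider `∫∫∫ p(a⁻¹) Δ(a⁻¹) q(s(a), y)` over arrows `a` and arrows `(s(a), y)` of
`H⁽⁰⁾ ⋊ G`. The modular property of `Δ`, applied before and after the measure-preserving flip
`(a, y) ↦ (a y, y⁻¹)`, turns it into the two sides. -/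
theorem lintegral_unit_inv (hlamH : IsHaarSystem lamH) (hlamG : IsHaarSystem lamG)
    (hinv : A.IsInvariant lamH) {μ : Measure (UnitSpace H)} {Δ : A.Semidirect → ℝ}
    (hΔ : IsModularFunction (A.semidirectHaar lamH lamG) (μ.map A.semidirectUnit) Δ)
    {q : UnitSpace H × G → ℝ≥0∞} (hq : Measurable q) :
    ∫⁻ v, ∫⁻ y, q (A.actUB (inv y) v, inv y)
        * A.modularExt Δ ((A.actUB (inv y) v).1, inv y) ∂(lamG (A.momentU v)) ∂μ
      = ∫⁻ v, ∫⁻ y, q (v, y) ∂(lamG (A.momentU v)) ∂μ := by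
  obtain ⟨pH, hpH, -, -, hpH1⟩ := hlamH.exists_lintegral_eq_one
  obtain ⟨pG, hpG, -, -, hpG1⟩ := hlamG.exists_lintegral_eq_one
  let p : H × G → ℝ≥0∞ := fun a => pH a.1 * pG a.2
  have hp : Measurable p := (hpH.comp measurable_fst).mul (hpG.comp measurable_snd)
  have hp1 : ∀ v, ∫⁻ a, p a ∂(A.prodKernel hlamH hlamG v) = 1 := fun v => by
    rw [A.lintegral_prodKernel _ _ _ hp]
    simp only [p]
    simp_rw [lintegral_const_mul _ hpG, hpG1, mul_one, hpH1]
  have hi : Measurable (inv : G → G) := TopologicalGroupoid.continuous_inv.measurable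
  -- the common value of the two sides: swapping `x` and `z` is the flip `(a, y) ↦ (a y, y⁻¹)`
  have hflip : ∀ v, ∫⁻ a, ∫⁻ z, A.flipIntegrand Δ p q a.1 a.2 z ∂(lamG (A.momentU v))
        ∂(A.prodKernel hlamH hlamG v)
      = ∫⁻ a, ∫⁻ z, A.flipIntegrand Δ p q a.1 z a.2 ∂(lamG (A.momentU v))
        ∂(A.prodKernel hlamH hlamG v) := fun v => by
    have hsf := hlamG.sFinite (A.momentU v)
    have hm := A.measurable_flipIntegrand hΔ.measurable hp hq
    have e1 : Measurable fun t : (H × G) × G => A.flipIntegrand Δ p q t.1.1 t.1.2 t.2 :=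
      hm.comp (g := fun t : H × G × G => A.flipIntegrand Δ p q t.1 t.2.1 t.2.2)
        (f := fun t : (H × G) × G => (t.1.1, t.1.2, t.2)) (by fun_prop)
    have e2 : Measurable fun t : (H × G) × G => A.flipIntegrand Δ p q t.1.1 t.2 t.1.2 :=
      hm.comp (g := fun t : H × G × G => A.flipIntegrand Δ p q t.1 t.2.1 t.2.2)
        (f := fun t : (H × G) × G => (t.1.1, t.2, t.1.2)) (by fun_prop)
    rw [A.lintegral_prodKernel _ _ _ e1.lintegral_prod_right',
      A.lintegral_prodKernel _ _ _ e2.lintegral_prod_right']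
    refine lintegral_congr fun k => ?_
    refine lintegral_lintegral_swap (f := fun x z => A.flipIntegrand Δ p q k x z)
      (Measurable.aemeasurable ?_)
    exact hm.comp (measurable_const.prodMk measurable_id)
  have hright : ∫⁻ v, ∫⁻ a, ∫⁻ z, A.flipIntegrand Δ p q a.1 a.2 z ∂(lamG (A.momentU v))
        ∂(A.prodKernel hlamH hlamG v) ∂μ
      = ∫⁻ v, ∫⁻ y, q (v, y) ∂(lamG (A.momentU v)) ∂μ := by
    have hQ : Measurable fun w : UnitSpace H => ∫⁻ y, q (w, y) ∂(lamG (A.momentU w)) :=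
      hq.lintegral_kernel_prod_right' (κ := hlamG.kernel.comap _ A.measurable_momentU)
    have h := A.lintegral_invB hlamH hlamG hΔ
      (f := fun b => p b * ∫⁻ y, q (rngU b.1, y) ∂(lamG (A.momentU (rngU b.1))))
      (hp.mul (hQ.comp (continuous_rngU.measurable.comp measurable_fst)))
    refine Eq.trans ?_ (h.trans ?_)
    · refine lintegral_congr fun v => lintegral_congr_ae ?_
      filter_upwards [A.ae_prodKernel hlamH hlamG v] with a ha
      have : A.momentU v = rngU a.2 := Subtype.ext ha.2.symm
      rw [this]
      exact A.lintegral_flipIntegrand_right hlamG hΔ.measurable hp hq (A.moment_eq_rng ha)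
    · refine lintegral_congr fun v => ?_
      rw [← one_mul (∫⁻ y, q (v, y) ∂(lamG (A.momentU v))), ← hp1 v,
        ← lintegral_mul_const _ hp]
      refine lintegral_congr_ae ?_
      filter_upwards [A.ae_prodKernel hlamH hlamG v] with a ha
      have : rngU a.1 = v := Subtype.ext ha.1
      simp only [this]
  have hleft : ∫⁻ v, ∫⁻ a, ∫⁻ z, A.flipIntegrand Δ p q a.1 z a.2 ∂(lamG (A.momentU v))
        ∂(A.prodKernel hlamH hlamG v) ∂μ
      = ∫⁻ v, ∫⁻ y, q (A.actUB (inv y) v, inv y)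
        * A.modularExt Δ ((A.actUB (inv y) v).1, inv y) ∂(lamG (A.momentU v)) ∂μ := by
    have h := A.lintegral_invB hlamH hlamG hΔ
      (A.measurable_convolve hlamG hΔ.measurable hp hq)
    refine Eq.trans ?_ (h.trans ?_)
    · refine lintegral_congr fun v => lintegral_congr_ae ?_
      filter_upwards [A.ae_prodKernel hlamH hlamG v] with a ha
      have : A.momentU v = rngU a.2 := Subtype.ext ha.2.symm
      rw [this]
      exact A.lintegral_flipIntegrand_left hlamG hΔ hp hq (A.moment_eq_rng ha)
    · refine lintegral_congr fun v => ?_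
      have hsf := hlamG.sFinite (A.momentU v)
      have m1 : Measurable fun t : (H × G) × G => p (A.actB (inv t.2) t.1.1, mulB (inv t.2) t.1.2) :=
        hp.comp ((A.measurable_actB.comp ((hi.comp measurable_snd).prodMk
          (measurable_fst.comp measurable_fst))).prodMk
          (measurable_mulB.comp ((hi.comp measurable_snd).prodMk
            (measurable_snd.comp measurable_fst))))
      have m3 : Measurable fun y : G => A.actUB (inv y) v :=
        A.measurable_actUB.comp (hi.prodMk measurable_const)
      have m2 : Measurable fun y : G => A.modularExt Δ ((A.actUB (inv y) v).1, inv y)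
          * q (A.actUB (inv y) v, inv y) :=
        ((A.measurable_modularExt hΔ.measurable).comp
          ((measurable_subtype_coe.comp m3).prodMk hi)).mul (hq.comp (m3.prodMk hi))
      calc ∫⁻ a, A.convolve lamG Δ p q a ∂(A.prodKernel hlamH hlamG v)
          = ∫⁻ a, ∫⁻ y, p (A.actB (inv y) a.1, mulB (inv y) a.2)
              * (A.modularExt Δ ((A.actUB (inv y) v).1, inv y)
                * q (A.actUB (inv y) v, inv y)) ∂(lamG (A.momentU v))
              ∂(A.prodKernel hlamH hlamG v) := by
            refine lintegral_congr_ae ?_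
            filter_upwards [A.ae_prodKernel hlamH hlamG v] with a ha
            have : rngU a.1 = v := Subtype.ext ha.1
            simp only [convolve, this]
        _ = ∫⁻ y, ∫⁻ a, p (A.actB (inv y) a.1, mulB (inv y) a.2)
              * (A.modularExt Δ ((A.actUB (inv y) v).1, inv y)
                * q (A.actUB (inv y) v, inv y)) ∂(A.prodKernel hlamH hlamG v)
              ∂(lamG (A.momentU v)) :=
            lintegral_lintegral_swap (m1.mul (m2.comp measurable_snd)).aemeasurable
        _ = _ := by
            refine lintegral_congr_ae ?_
            filter_upwards [hlamG.ae_rng_eq (A.momentU v)] with y hy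
            have m4 : Measurable fun a : H × G => p (A.actB (inv y) a.1, mulB (inv y) a.2) :=
              m1.comp (measurable_id.prodMk measurable_const)
            rw [lintegral_mul_const _ m4,
              A.lintegral_prodKernel_act hlamH hlamG hinv (by rw [src_inv, hy]) hp, hp1,
              one_mul, mul_comm]
  rw [← hleft, ← hright]
  exact (lintegral_congr hflip).symm

end IsoAction

/-! ### Null sets of a quasi-invariant measure -/

namespace IsModularFunction

/-- A homomorphism into `(0, ∞)` is `1` at units, as its value there is idempotent. -/
theorem apply_inv_mul {G : Type*} [MeasurableSpace G] [AlgGroupoid G]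
    {lam : UnitSpace G → Measure G} {m : Measure (UnitSpace G)} {D : G → ℝ}
    (hD : IsModularFunction lam m D) (x : G) : D (inv x) * D x = 1 := by
  have h1 : D (src x) = D (inv x) * D x := by
    rw [← AlgGroupoid.inv_mul_eq, hD.map_mul _ _ (AlgGroupoid.src_inv x)]
  have h2 : D x = D x * D (src x) := by
    rw [← hD.map_mul _ _ (AlgGroupoid.rng_src x).symm, AlgGroupoid.mul_src_self]
  rw [← h1]
  exact (mul_right_eq_self₀.1 h2.symm).resolve_right (hD.pos x).ne'

variable {G : Type*} [TopologicalSpace G] [LocallyCompactSpace G] [T2Space G]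
  [SecondCountableTopology G] [MeasurableSpace G] [BorelSpace G] [TopologicalGroupoid G]
  {lam : UnitSpace G → Measure G} {m : Measure (UnitSpace G)} {D : G → ℝ}

theorem lintegral_bind_inv (hlam : IsHaarSystem lam) (hD : IsModularFunction lam m D)
    {f : G → ℝ≥0∞} (hf : Measurable f) :
    ∫⁻ x, f (inv x) * ENNReal.ofReal (D (inv x)) ∂(m.bind lam) = ∫⁻ x, f x ∂(m.bind lam) := by
  have hi : Measurable (inv : G → G) := TopologicalGroupoid.continuous_inv.measurable
  rw [Measure.lintegral_bind hlam.measurable.aemeasurable hf.aemeasurable,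
    Measure.lintegral_bind hlam.measurable.aemeasurable]
  · exact hD.lintegral_inv f hf
  · exact ((hf.comp hi).mul
      (ENNReal.measurable_ofReal.comp (hD.measurable.comp hi))).aemeasurable

/-- Inversion preserves the null sets of `∫ λᵘ dm(u)`, since `D` is strictly positive. -/
theorem ae_inv (hlam : IsHaarSystem lam) (hD : IsModularFunction lam m D) {P : G → Prop}
    (h : ∀ᵐ x ∂(m.bind lam), P x) : ∀ᵐ x ∂(m.bind lam), P (inv x) := by
  have hi : Measurable (inv : G → G) := TopologicalGroupoid.continuous_inv.measurable
  let N := toMeasurable (m.bind lam) {x | ¬ P x}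
  have hN : MeasurableSet N := measurableSet_toMeasurable _ _
  have hN0 : m.bind lam N = 0 := (measure_toMeasurable _).trans (ae_iff.1 h)
  have h1 := hD.lintegral_bind_inv hlam (f := N.indicator 1) (measurable_one.indicator hN)
  have hm : Measurable fun x => N.indicator (1 : G → ℝ≥0∞) (inv x) * ENNReal.ofReal (D (inv x)) :=
    ((measurable_one.indicator hN).comp hi).mul
      (ENNReal.measurable_ofReal.comp (hD.measurable.comp hi))
  rw [lintegral_indicator_one hN, hN0, lintegral_eq_zero_iff hm] at h1
  filter_upwards [h1] with x hx
  by_contra hPx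
  have : inv x ∈ N := subset_toMeasurable _ _ hPx
  simp [this] at hx
  exact absurd (hD.pos (inv x)) hx.not_gt

/-- The reduction to a conull set of units is conull. -/
theorem ae_reduction (hlam : IsHaarSystem lam) (hD : IsModularFunction lam m D)
    {U : Set (UnitSpace G)} (hU : ∀ᵐ u ∂m, u ∈ U) : ∀ᵐ x ∂(m.bind lam), x ∈ reduction U := by
  have h1 : ∀ᵐ x ∂(m.bind lam), rngU x ∈ U := by
    let N := toMeasurable m Uᶜ
    have hN : MeasurableSet N := measurableSet_toMeasurable _ _
    have hN0 : m N = 0 := (measure_toMeasurable _).trans hU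
    have h0 : m.bind lam (rngU ⁻¹' N) = 0 := by
      rw [Measure.bind_apply (continuous_rngU.measurable hN) hlam.measurable.aemeasurable]
      refine lintegral_eq_zero_of_ae_eq_zero ?_
      filter_upwards [compl_mem_ae_iff.2 hN0] with u hu
      refine measure_eq_zero_iff_ae_notMem.2 ?_
      filter_upwards [hlam.ae_rngU_eq u] with x hx hxN
      rw [mem_preimage, hx] at hxN
      exact hu hxN
    filter_upwards [compl_mem_ae_iff.2 h0] with x hx
    by_contra hxU
    exact hx (subset_toMeasurable m Uᶜ hxU)
  filter_upwards [h1, hD.ae_inv hlam h1] with x hx hx'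
  rw [rngU_inv] at hx'
  exact ⟨hx, hx'⟩

end IsModularFunction

namespace IsoAction

open AlgGroupoid (rng_inv src_inv rng_src src_rng rng_rng src_src inv_inv_eq)

variable {G H : Type*}
  [TopologicalSpace G] [LocallyCompactSpace G] [T2Space G] [SecondCountableTopology G]
  [MeasurableSpace G] [BorelSpace G] [TopologicalGroupoid G]
  [TopologicalSpace H] [LocallyCompactSpace H] [T2Space H] [SecondCountableTopology H]
  [MeasurableSpace H] [BorelSpace H] [TopologicalGroupoid H]
  (A : IsoAction G H)
  {lamG : UnitSpace G → Measure G} {lamH : UnitSpace H → Measure H}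

/-! ### Transport of the fibre measures -/

/-- The arrow `x` carries the fibre measure over its range to the one over its source, with
density `δ(·, x⁻¹) Δ_G(x)`. -/
def Transports (κ : Kernel (UnitSpace G) (UnitSpace H)) (Δ : A.Semidirect → ℝ) (ΔG : G → ℝ)
    (x : G) : Prop :=
  ∀ φ : UnitSpace H → ℝ≥0∞, Measurable φ →
    ∫⁻ v, φ v ∂(κ (srcU x)) = ∫⁻ v, φ (A.actUB (inv x) v)
      * (A.modularExt Δ ((A.actUB (inv x) v).1, inv x) * ENNReal.ofReal (ΔG x)) ∂(κ (rngU x))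

theorem measurable_modularExt_actUB {Δ : A.Semidirect → ℝ} (hΔ : Measurable Δ) :
    Measurable fun t : UnitSpace H × G =>
      A.modularExt Δ ((A.actUB (inv t.2) t.1).1, inv t.2) := by
  have hi : Measurable fun t : UnitSpace H × G => inv t.2 :=
    TopologicalGroupoid.continuous_inv.measurable.comp measurable_snd
  exact (A.measurable_modularExt hΔ).comp ((measurable_subtype_coe.comp
    (A.measurable_actUB.comp (hi.prodMk measurable_fst))).prodMk hi)

/-- Transport is compatible with products, since `Δ` and `Δ_G` are homomorphisms. -/
theorem Transports.mul {κ : Kernel (UnitSpace G) (UnitSpace H)}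
    {l : UnitSpace A.Semidirect → Measure A.Semidirect} {m : Measure (UnitSpace A.Semidirect)}
    {Δ : A.Semidirect → ℝ} (hΔ : IsModularFunction l m Δ) {lG : UnitSpace G → Measure G}
    {mG : Measure (UnitSpace G)} {ΔG : G → ℝ} (hΔG : IsModularFunction lG mG ΔG) {x y : G}
    (hxy : src x = rng y) (hfib : ∀ᵐ v ∂(κ (rngU x)), A.momentU v = rngU x)
    (hx : A.Transports κ Δ ΔG x) (hy : A.Transports κ Δ ΔG y) :
    A.Transports κ Δ ΔG (mul x y) := by
  intro φ hφ
  have hs : srcU (AlgGroupoid.mul x y) = srcU y := Subtype.ext (AlgGroupoid.src_mul _ _ hxy)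
  have hr : rngU (AlgGroupoid.mul x y) = rngU x := Subtype.ext (AlgGroupoid.rng_mul _ _ hxy)
  have hyx : rngU y = srcU x := Subtype.ext hxy.symm
  have hc1 : src (inv y) = rng (inv x) := by rw [src_inv, rng_inv, hxy]
  have hixy : inv (AlgGroupoid.mul x y) = AlgGroupoid.mul (inv y) (inv x) :=
    inv_mul_rev x y hxy
  have hmeas : Measurable fun v => φ (A.actUB (inv y) v)
      * (A.modularExt Δ ((A.actUB (inv y) v).1, inv y) * ENNReal.ofReal (ΔG y)) :=
    (hφ.comp (A.measurable_actUB.comp (measurable_const.prodMk measurable_id))).mul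
      (((A.measurable_modularExt_actUB hΔ.measurable).comp
        (measurable_id.prodMk measurable_const)).mul measurable_const)
  rw [hs, hr, hy φ hφ, hyx, hx _ hmeas]
  refine lintegral_congr_ae ?_
  filter_upwards [hfib] with v hv
  have hv1 : src (inv x) = (A.momentU v : G) := by rw [src_inv, hv]; rfl
  -- the units `x⁻¹ · v` and `(x y)⁻¹ · v` as elements of `H`
  have e1 : (A.actUB (inv x) v : H) = A.act (inv x) v.1 := by
    rw [A.actUB_eq hv1, A.coe_actU _ _ hv1]
  have hv2 : src (inv y) = (A.momentU (A.actUB (inv x) v) : G) := by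
    rw [A.coe_momentU_actUB hv1, hc1]
  have e2 : (A.actUB (inv y) (A.actUB (inv x) v) : H) = A.act (inv y) (A.act (inv x) v.1) := by
    rw [A.actUB_eq hv2, A.coe_actU _ _ hv2, e1]
  have hv3 : src (AlgGroupoid.mul (inv y) (inv x)) = (A.momentU v : G) := by
    rw [AlgGroupoid.src_mul _ _ hc1, hv1]
  have e3 : A.actUB (AlgGroupoid.mul (inv y) (inv x)) v
      = A.actUB (inv y) (A.actUB (inv x) v) := by
    refine Subtype.ext ?_
    rw [e2, A.actUB_eq hv3, A.coe_actU _ _ hv3, A.act_act _ _ _ hc1 hv1]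
  have hk : (A.moment (A.act (inv y) (A.act (inv x) v.1)) : G) = rng (inv y) := by
    rw [← e2]
    exact A.coe_momentU_actUB hv2
  have hunit : rng (A.act (inv x) v.1) = A.act (inv x) v.1 := by
    rw [← e1]; exact (A.actUB (inv x) v).2
  have hunit2 : rng (A.act (inv y) (A.act (inv x) v.1)) = A.act (inv y) (A.act (inv x) v.1) := by
    rw [← e2]; exact (A.actUB (inv y) (A.actUB (inv x) v)).2
  have hmul : A.modularExt Δ ((A.actUB (inv y) (A.actUB (inv x) v)).1,
        AlgGroupoid.mul (inv y) (inv x))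
      = A.modularExt Δ ((A.actUB (inv y) (A.actUB (inv x) v)).1, inv y)
        * A.modularExt Δ ((A.actUB (inv x) v).1, inv x) := by
    rw [e2, e1, ← A.modularExt_mul hΔ hk hc1 ?_ ?_]
    · congr 2
      have := AlgGroupoid.rng_mul_self (A.act (inv y) (A.act (inv x) v.1))
      rw [hunit2] at this
      exact this.symm
    · rw [hunit]
      have := src_rng (A.act (inv y) (A.act (inv x) v.1))
      rwa [hunit2] at this
    · rw [← e1]
      exact A.coe_momentU_actUB hv1
  rw [hixy, e3, hmul, hΔG.map_mul _ _ hxy, ENNReal.ofReal_mul (hΔG.pos x).le]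
  ring

/-- Integration over `H⁽⁰⁾ ⋊ G`, disintegrated over `G⁽⁰⁾`. -/
theorem lintegral_disintegration (hlamG : IsHaarSystem lamG) {μ : Measure (UnitSpace H)}
    {κ : Kernel (UnitSpace G) (UnitSpace H)} [IsFiniteKernel κ]
    (hκ : IsDisintegration μ A.momentU κ) {g : UnitSpace H × G → ℝ≥0∞} (hg : Measurable g) :
    ∫⁻ v, ∫⁻ y, g (v, y) ∂(lamG (A.momentU v)) ∂μ
      = ∫⁻ y, ∫⁻ v, g (v, y) ∂(κ (rngU y)) ∂((μ.map A.momentU).bind lamG) := by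
  have hm : Measurable fun y : G => ∫⁻ v, g (v, y) ∂(κ (rngU y)) :=
    (hg.comp measurable_swap).lintegral_kernel_prod_right'
      (κ := κ.comap rngU continuous_rngU.measurable)
  have hm' : Measurable fun v => ∫⁻ y, g (v, y) ∂(lamG (A.momentU v)) :=
    hg.lintegral_kernel_prod_right' (κ := hlamG.kernel.comap _ A.measurable_momentU)
  rw [hκ.lintegral_eq _ hm', Measure.lintegral_bind hlamG.measurable.aemeasurable hm.aemeasurable]
  refine lintegral_congr_ae ?_
  filter_upwards [hκ.ae_fibre] with u hu
  have hsf := hlamG.sFinite u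
  calc ∫⁻ v, ∫⁻ y, g (v, y) ∂(lamG (A.momentU v)) ∂(κ u)
      = ∫⁻ v, ∫⁻ y, g (v, y) ∂(lamG u) ∂(κ u) := by
        refine lintegral_congr_ae ?_
        filter_upwards [show ∀ᵐ v ∂(κ u), A.momentU v = u from hu] with v hv
        rw [hv]
    _ = ∫⁻ y, ∫⁻ v, g (v, y) ∂(κ u) ∂(lamG u) := lintegral_lintegral_swap hg.aemeasurable
    _ = _ := by
        refine lintegral_congr_ae ?_
        filter_upwards [hlamG.ae_rngU_eq u] with y hy
        rw [hy]

/-- Disintegrating both modular identities, that of `δ` on `H⁽⁰⁾ ⋊ G` and that of `Δ_G` on `G`,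
gives the transport identity on each set of a countable `π`-system, for almost every arrow. -/
theorem ae_transports (hlamH : IsHaarSystem lamH) (hlamG : IsHaarSystem lamG)
    (hinv : A.IsInvariant lamH) {μ : Measure (UnitSpace H)} [IsFiniteMeasure μ]
    {Δ : A.Semidirect → ℝ}
    (hΔ : IsModularFunction (A.semidirectHaar lamH lamG) (μ.map A.semidirectUnit) Δ)
    {ΔG : G → ℝ} (hΔG : IsModularFunction lamG (μ.map A.momentU) ΔG)
    {κ : Kernel (UnitSpace G) (UnitSpace H)} [IsFiniteKernel κ]
    (hκ : IsDisintegration μ A.momentU κ) :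
    ∀ᵐ x ∂((μ.map A.momentU).bind lamG), A.Transports κ Δ ΔG x := by
  have hi : Measurable (inv : G → G) := TopologicalGroupoid.continuous_inv.measurable
  obtain ⟨p, hp, hp0, hptop, hp1⟩ := hlamG.exists_lintegral_eq_one
  set ν := (μ.map A.momentU).bind lamG with hν
  have hfin : IsFiniteMeasure (ν.withDensity p) := ⟨by
    rw [withDensity_apply _ MeasurableSet.univ, setLIntegral_univ, hν,
      Measure.lintegral_bind hlamG.measurable.aemeasurable hp.aemeasurable]
    simp_rw [hp1, lintegral_one]
    exact measure_lt_top _ _⟩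
  have hd : Measurable fun t : UnitSpace H × G =>
      A.modularExt Δ ((A.actUB (inv t.2) t.1).1, inv t.2) :=
    A.measurable_modularExt_actUB hΔ.measurable
  have hact : Measurable fun t : UnitSpace H × G => A.actUB (inv t.2) t.1 :=
    A.measurable_actUB.comp ((hi.comp measurable_snd).prodMk measurable_fst)
  have key : ∀ B : Set (UnitSpace H), MeasurableSet B → ∀ᵐ y ∂ν,
      κ (srcU y) B * ENNReal.ofReal (ΔG (inv y))
        = ∫⁻ v, B.indicator 1 (A.actUB (inv y) v)
          * A.modularExt Δ ((A.actUB (inv y) v).1, inv y) ∂(κ (rngU y)) := by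
    intro B hB
    have hBi : Measurable (B.indicator (1 : UnitSpace H → ℝ≥0∞)) := measurable_one.indicator hB
    have hg : Measurable fun t : UnitSpace H × G => B.indicator 1 (A.actUB (inv t.2) t.1)
        * A.modularExt Δ ((A.actUB (inv t.2) t.1).1, inv t.2) := (hBi.comp hact).mul hd
    have hm1 : Measurable fun y => κ (srcU y) B * ENNReal.ofReal (ΔG (inv y)) :=
      ((κ.measurable_coe hB).comp continuous_srcU.measurable).mul
        (ENNReal.measurable_ofReal.comp (hΔG.measurable.comp hi))
    have hm2 : Measurable fun y => ∫⁻ v, B.indicator 1 (A.actUB (inv y) v)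
        * A.modularExt Δ ((A.actUB (inv y) v).1, inv y) ∂(κ (rngU y)) :=
      (hg.comp measurable_swap).lintegral_kernel_prod_right'
        (κ := κ.comap rngU continuous_rngU.measurable)
    have hψ : ∀ ψ : G → ℝ≥0∞, Measurable ψ →
        ∫⁻ y, ψ y * (κ (srcU y) B * ENNReal.ofReal (ΔG (inv y))) ∂ν
          = ∫⁻ y, ψ y * ∫⁻ v, B.indicator 1 (A.actUB (inv y) v)
            * A.modularExt Δ ((A.actUB (inv y) v).1, inv y) ∂(κ (rngU y)) ∂ν := by
      intro ψ hψ
      have hq : Measurable fun t : UnitSpace H × G => B.indicator (1 : UnitSpace H → ℝ≥0∞) t.1 * ψ (inv t.2) :=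
        (hBi.comp measurable_fst).mul (hψ.comp (hi.comp measurable_snd))
      have h1 := A.lintegral_unit_inv hlamH hlamG hinv hΔ hq
      rw [A.lintegral_disintegration hlamG hκ hq,
        A.lintegral_disintegration hlamG hκ (g := fun t => (B.indicator (1 : UnitSpace H → ℝ≥0∞)
          (A.actUB (inv t.2) t.1) * ψ (inv (inv t.2)))
          * A.modularExt Δ ((A.actUB (inv t.2) t.1).1, inv t.2))
          (((hBi.comp hact).mul (hψ.comp (hi.comp (hi.comp measurable_snd)))).mul hd), ← hν] at h1
      have h2 := hΔG.lintegral_bind_inv hlamG (f := fun y => ψ (inv y) * κ (rngU y) B)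
        ((hψ.comp hi).mul ((κ.measurable_coe hB).comp continuous_rngU.measurable))
      rw [← hν] at h2
      calc ∫⁻ y, ψ y * (κ (srcU y) B * ENNReal.ofReal (ΔG (inv y))) ∂ν
          = ∫⁻ y, ψ (inv y) * κ (rngU y) B ∂ν := by
            rw [← h2]
            refine lintegral_congr fun y => ?_
            rw [inv_inv_eq, rngU_inv, mul_assoc]
        _ = ∫⁻ y, ∫⁻ v, B.indicator 1 v * ψ (inv y) ∂(κ (rngU y)) ∂ν := by
            refine lintegral_congr fun y => ?_
            rw [lintegral_mul_const _ hBi, lintegral_indicator_one hB, mul_comm]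
        _ = _ := by
            rw [← h1]
            refine lintegral_congr fun y => ?_
            have hgy : Measurable fun v => B.indicator (1 : UnitSpace H → ℝ≥0∞) (A.actUB (inv y) v)
                * A.modularExt Δ ((A.actUB (inv y) v).1, inv y) :=
              hg.comp (measurable_id.prodMk measurable_const)
            rw [← lintegral_const_mul _ hgy]
            refine lintegral_congr fun v => ?_
            rw [inv_inv_eq]
            ring
    -- the density `p` makes the measure finite without changing its null sets
    have h3 := ae_eq_of_forall_setLIntegral_eq_of_sigmaFinite (μ := ν.withDensity p) hm1 hm2
      fun C hC _ => by
        rw [setLIntegral_withDensity_eq_setLIntegral_mul _ hp hm1 hC,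
          setLIntegral_withDensity_eq_setLIntegral_mul _ hp hm2 hC,
          ← lintegral_indicator hC, ← lintegral_indicator hC]
        have := hψ (C.indicator p) (hp.indicator hC)
        refine Eq.trans (lintegral_congr fun y => ?_) (this.trans (lintegral_congr fun y => ?_))
        · exact indicator_mul_left C p _
        · symm
          exact indicator_mul_left C p _
    have h4 := (ae_withDensity_iff hp).1 h3
    filter_upwards [h4] with y hy using hy (hp0 y)
  obtain ⟨C, hC, hCpi, hCgen⟩ := exists_countable_isPiSystem (UnitSpace H)
  have hCm : ∀ B ∈ C, MeasurableSet B := fun B hB => by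
    rw [hCgen]
    exact MeasurableSpace.measurableSet_generateFrom hB
  have hall : ∀ᵐ y ∂ν, ∀ B ∈ C, κ (srcU y) B * ENNReal.ofReal (ΔG (inv y))
        = ∫⁻ v, B.indicator 1 (A.actUB (inv y) v)
          * A.modularExt Δ ((A.actUB (inv y) v).1, inv y) ∂(κ (rngU y)) :=
    (ae_ball_iff hC).2 fun B hB => key B (hCm B hB)
  filter_upwards [hall, key univ MeasurableSet.univ] with y hyC hyU
  have hactm : Measurable (A.actUB (inv y)) :=
    A.measurable_actUB.comp (measurable_const.prodMk measurable_id)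
  have hdm : Measurable fun v => A.modularExt Δ ((A.actUB (inv y) v).1, inv y)
      * ENNReal.ofReal (ΔG y) :=
    (hd.comp (measurable_id.prodMk measurable_const)).mul measurable_const
  have hset : ∀ B, MeasurableSet B → κ (srcU y) B * ENNReal.ofReal (ΔG (inv y))
        = ∫⁻ v, B.indicator 1 (A.actUB (inv y) v)
          * A.modularExt Δ ((A.actUB (inv y) v).1, inv y) ∂(κ (rngU y)) →
      κ (srcU y) B = ((κ (rngU y)).withDensity fun v =>
        A.modularExt Δ ((A.actUB (inv y) v).1, inv y)
          * ENNReal.ofReal (ΔG y)).map (A.actUB (inv y)) B := by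
    intro B hB h
    have hg : Measurable fun v => B.indicator (1 : UnitSpace H → ℝ≥0∞) (A.actUB (inv y) v)
        * A.modularExt Δ ((A.actUB (inv y) v).1, inv y) :=
      ((measurable_one.indicator hB).comp hactm).mul
        (hd.comp (measurable_id.prodMk measurable_const))
    calc κ (srcU y) B
        = κ (srcU y) B * ENNReal.ofReal (ΔG (inv y)) * ENNReal.ofReal (ΔG y) := by
          rw [mul_assoc, ← ENNReal.ofReal_mul (hΔG.pos _).le, hΔG.apply_inv_mul,
            ENNReal.ofReal_one, mul_one]
      _ = _ := by
          rw [h, ← lintegral_mul_const _ hg, Measure.map_apply hactm hB,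
            withDensity_apply _ (hactm hB), ← lintegral_indicator (hactm hB)]
          refine lintegral_congr fun v => ?_
          by_cases hv : A.actUB (inv y) v ∈ B
          · rw [indicator_of_mem hv, indicator_of_mem (show v ∈ A.actUB (inv y) ⁻¹' B from hv),
              Pi.one_apply, one_mul]
          · rw [indicator_of_notMem hv,
              indicator_of_notMem (show v ∉ A.actUB (inv y) ⁻¹' B from hv), zero_mul, zero_mul]
  have hmeas := ext_of_generate_finite C hCgen hCpi (fun B hB => hset B (hCm B hB) (hyC B hB))
    (hset univ MeasurableSet.univ hyU)
  intro φ hφ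
  rw [hmeas, lintegral_map hφ hactm]
  refine (lintegral_withDensity_eq_lintegral_mul _ hdm (hφ.comp hactm)).trans ?_
  exact lintegral_congr fun v => mul_comm _ _

/-- The arrows that transport the fibre measures form a conull set closed under products, and such
a set contains the reduction to a conull set of units: if almost every `y` in the fibres over
`r(x)` and `s(x)` is, together with its inverse, in this set, then so is `x = (x z) z⁻¹` for a
suitable `z`. -/
theorem exists_transports (hlamH : IsHaarSystem lamH) (hlamG : IsHaarSystem lamG)
    (hinv : A.IsInvariant lamH) {μ : Measure (UnitSpace H)} [IsFiniteMeasure μ]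
    {Δ : A.Semidirect → ℝ}
    (hΔ : IsModularFunction (A.semidirectHaar lamH lamG) (μ.map A.semidirectUnit) Δ)
    {ΔG : G → ℝ} (hΔG : IsModularFunction lamG (μ.map A.momentU) ΔG)
    {κ : Kernel (UnitSpace G) (UnitSpace H)} [IsFiniteKernel κ]
    (hκ : IsDisintegration μ A.momentU κ) :
    ∃ U : Set (UnitSpace G), (∀ᵐ u ∂(μ.map A.momentU), u ∈ U) ∧
      ∀ x ∈ reduction U, A.Transports κ Δ ΔG x := by
  have h1 := A.ae_transports hlamH hlamG hinv hΔ hΔG hκ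
  have h2 := Measure.ae_ae_of_ae_bind hlamG.measurable.aemeasurable
    (h1.and (hΔG.ae_inv hlamG h1))
  refine ⟨{u | κ u {v | A.momentU v ≠ u} = 0 ∧
    ∀ᵐ y ∂(lamG u), A.Transports κ Δ ΔG y ∧ A.Transports κ Δ ΔG (inv y)}, ?_, ?_⟩
  · filter_upwards [h2, hκ.ae_fibre] with u hu hu' using ⟨hu', hu⟩
  · rintro x ⟨⟨hf, hr⟩, -, hs⟩
    have : (ae (lamG (srcU x))).NeBot := ae_neBot.2 (hlamG.ne_zero _)
    obtain ⟨z, ⟨hxz, -⟩, ⟨-, hz⟩, hz'⟩ :=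
      ((hlamG.ae_mul_left x hr).and (hs.and (hlamG.ae_rng_eq (srcU x)))).exists
    have hxz' : src x = rng z := hz'.symm
    have hc : src (mul x z) = rng (inv z) := by
      rw [AlgGroupoid.src_mul _ _ hxz', rng_inv]
    have hx : mul (mul x z) (inv z) = x := by
      rw [AlgGroupoid.mul_mul_eq _ _ _ hxz' (rng_inv z).symm, AlgGroupoid.mul_inv_eq, ← hxz',
        AlgGroupoid.mul_src_self]
    rw [← hx]
    refine Transports.mul A hΔ hΔG hc ?_ hxz hz
    have : rngU (mul x z) = rngU x := Subtype.ext (AlgGroupoid.rng_mul _ _ hxz')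
    rw [this]
    exact hf

/-- The transport identity in terms of the original action and of `δ`. -/
theorem Transports.withDensity_translate {κ : Kernel (UnitSpace G) (UnitSpace H)}
    {Δ : A.Semidirect → ℝ} (hΔ : Measurable Δ) {ΔG : G → ℝ} {x : G} (hpos : 0 ≤ ΔG x)
    (hfib : ∀ᵐ v ∂(κ (rngU x)), A.momentU v = rngU x) (hx : A.Transports κ Δ ΔG x) :
    κ (srcU x) = (A.translate (inv x) (κ (rngU x))).withDensity
        (fun v => ENNReal.ofReal (A.unitRestriction Δ v (inv x) * ΔG x)) ∧
      ∀ φ : UnitSpace H → ℝ≥0∞, Measurable φ →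
        ∫⁻ v, φ v ∂(κ (srcU x)) = ∫⁻ v, φ (A.actU (inv x) v) *
          ENNReal.ofReal (A.unitRestriction Δ (A.actU (inv x) v) (inv x) * ΔG x)
            ∂(κ (rngU x)) := by
  have hfib' : ∀ᵐ v ∂(κ (rngU x)), src (inv x) = (A.momentU v : G) := by
    filter_upwards [hfib] with v hv
    rw [hv, src_inv]
    rfl
  have hact : A.actUB (inv x) =ᵐ[κ (rngU x)] A.actU (inv x) := by
    filter_upwards [hfib'] with v hv using A.actUB_eq hv
  have hden : ∀ v, ENNReal.ofReal (A.unitRestriction Δ v (inv x) * ΔG x)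
      = A.modularExt Δ (v.1, inv x) * ENNReal.ofReal (ΔG x) := fun v => by
    rw [ENNReal.ofReal_mul' hpos, ofReal_unitRestriction]
  have hmain : ∀ φ : UnitSpace H → ℝ≥0∞, Measurable φ →
      ∫⁻ v, φ v ∂(κ (srcU x)) = ∫⁻ v, φ (A.actU (inv x) v) *
        ENNReal.ofReal (A.unitRestriction Δ (A.actU (inv x) v) (inv x) * ΔG x)
          ∂(κ (rngU x)) := by
    intro φ hφ
    rw [hx φ hφ]
    refine lintegral_congr_ae ?_
    filter_upwards [hact] with v hv
    rw [hden, hv]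
  refine ⟨?_, hmain⟩
  have hdm : Measurable fun v : UnitSpace H =>
      ENNReal.ofReal (A.unitRestriction Δ v (inv x) * ΔG x) := by
    simp_rw [hden]
    exact ((A.measurable_modularExt hΔ).comp
      (measurable_subtype_coe.prodMk measurable_const)).mul measurable_const
  have ham : AEMeasurable (A.actU (inv x)) (κ (rngU x)) :=
    ⟨A.actUB (inv x), A.measurable_actUB.comp (measurable_const.prodMk measurable_id), hact.symm⟩
  ext B hB
  have hBi : Measurable (B.indicator (1 : UnitSpace H → ℝ≥0∞)) := measurable_one.indicator hB
  unfold translate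
  rw [Measure.restrict_eq_self_of_ae_mem (s := {v | src (inv x) = (A.momentU v : G)}) hfib',
    withDensity_apply _ hB, ← lintegral_indicator hB,
    lintegral_map' (hdm.indicator hB).aemeasurable ham, ← lintegral_indicator_one hB, hmain _ hBi]
  refine lintegral_congr fun v => ?_
  by_cases hv : A.actU (inv x) v ∈ B
  · rw [indicator_of_mem hv, indicator_of_mem hv, Pi.one_apply, one_mul]
  · rw [indicator_of_notMem hv, indicator_of_notMem hv, zero_mul]

end IsoAction

/-- Discarding the exceptional fibres, where it need not be finite, turns a disintegration into a
finite kernel. -/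
theorem IsDisintegration.exists_isFiniteKernel {X Y : Type*} [MeasurableSpace X]
    [MeasurableSpace Y] {μ : Measure X} {ρ : X → Y} {κ : Kernel Y X}
    (hκ : IsDisintegration μ ρ κ) : ∃ κ' : Kernel Y X, IsFiniteKernel κ' ∧
      IsDisintegration μ ρ κ' ∧ ∀ᵐ u ∂(μ.map ρ), κ' u = κ u := by
  classical
  have hs : MeasurableSet {u | κ u univ = 1} :=
    (κ.measurable_coe MeasurableSet.univ) (measurableSet_singleton 1)
  have hae : ∀ᵐ u ∂(μ.map ρ), Kernel.piecewise hs κ 0 u = κ u := by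
    filter_upwards [hκ.ae_isProbabilityMeasure] with u hu
    rw [Kernel.piecewise_apply, if_pos]
    exact hu.measure_univ
  refine ⟨Kernel.piecewise hs κ 0, ⟨1, ENNReal.one_lt_top, fun u => ?_⟩, ⟨?_, ?_, ?_⟩, hae⟩
  · rw [Kernel.piecewise_apply]
    split_ifs with hu
    · exact le_of_eq hu
    · simp
  · filter_upwards [hae, hκ.ae_isProbabilityMeasure] with u hu h
    rwa [hu]
  · filter_upwards [hae, hκ.ae_fibre] with u hu h
    rwa [hu]
  · intro f hf
    rw [hκ.lintegral_eq f hf]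
    refine lintegral_congr_ae ?_
    filter_upwards [hae] with u hu
    rw [hu]

end

theorem mainTheorem7 {G H : Type*}
    [TopologicalSpace G] [LocallyCompactSpace G] [T2Space G] [SecondCountableTopology G]
    [MeasurableSpace G] [BorelSpace G] [TopologicalGroupoid G]
    [TopologicalSpace H] [LocallyCompactSpace H] [T2Space H] [SecondCountableTopology H]
    [MeasurableSpace H] [BorelSpace H] [TopologicalGroupoid H]
    (A : IsoAction G H)
    (lamG : UnitSpace G → Measure G) (hlamG : IsHaarSystem lamG)
    (lamH : UnitSpace H → Measure H) (hlamH : IsHaarSystem lamH)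
    (hinv : A.IsInvariant lamH)
    (μ : Measure (UnitSpace H)) [IsFiniteMeasure μ]
    (Δ : A.Semidirect → ℝ)
    (hΔ : IsModularFunction (A.semidirectHaar lamH lamG) (μ.map A.semidirectUnit) Δ)
    (ΔG : G → ℝ) (hΔG : IsModularFunction lamG (μ.map A.momentU) ΔG)
    (κ : Kernel (UnitSpace G) (UnitSpace H)) (hκ : IsDisintegration μ A.momentU κ) :
    ∃ U : Set (UnitSpace G),
      (∀ᵐ u ∂(μ.map A.momentU), u ∈ U) ∧
      (∀ᵐ u ∂(μ.map A.momentU), ∀ᵐ x ∂(lamG u), x ∈ reduction U) ∧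
      ∀ x ∈ reduction U,
        κ (srcU x) = (A.translate (AlgGroupoid.inv x) (κ (rngU x))).withDensity
            (fun v => ENNReal.ofReal (A.unitRestriction Δ v (AlgGroupoid.inv x) * ΔG x)) ∧
        ∀ φ : UnitSpace H → ℝ≥0∞, Measurable φ →
          ∫⁻ v, φ v ∂(κ (srcU x)) =
            ∫⁻ v, φ (A.actU (AlgGroupoid.inv x) v) *
              ENNReal.ofReal (A.unitRestriction Δ (A.actU (AlgGroupoid.inv x) v) (AlgGroupoid.inv x) * ΔG x)
                ∂(κ (rngU x)) := by
  obtain ⟨κ', hfin, hκ', hae⟩ := hκ.exists_isFiniteKernel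
  obtain ⟨U, hU, hUx⟩ := A.exists_transports hlamH hlamG hinv hΔ hΔG hκ'
  have hV : ∀ᵐ u ∂(μ.map A.momentU),
      u ∈ {u | u ∈ U ∧ κ' u = κ u ∧ κ u {v | A.momentU v ≠ u} = 0} := by
    filter_upwards [hU, hae, hκ.ae_fibre] with u h1 h2 h3 using ⟨h1, h2, h3⟩
  refine ⟨_, hV, Measure.ae_ae_of_ae_bind hlamG.measurable.aemeasurable
    (hΔG.ae_reduction hlamG hV), ?_⟩
  rintro x ⟨⟨hr, hrκ, hrf⟩, hs, hsκ, -⟩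
  refine IsoAction.Transports.withDensity_translate A hΔ.measurable (hΔG.pos x).le hrf ?_
  intro φ hφ
  have h := hUx x ⟨hr, hs⟩ φ hφ
  rwa [hrκ, hsκ] at h
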